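/- A *skew left brace* is a set $A$ with two group structures $(A,\cdot)$ and $(A,\circ)$ such that $a\circ(b\cdot c)=(a\circ b)\cdot a^{-1}\cdot(a\circ c)$ for all $a,b,c\in A$, where $a^{-1}$ is the inverse in $(A,\cdot)$. A *representation* of $A$ is a triple $(V,\beta,\rho)$, where $V$ is a complex vector space and $\beta:(A,\cdot)\to \mathrm{GL}(V)$, $\rho:(A,\circ)\to \mathrm{GL}(V)$ are group homomorphisms with $\beta\big((a\circ b)\cdot a^{-1}\big)=\rho(a)\beta(b)\rho(a)^{-1}$ for all $a,b\in A$. It is *irreducible* if $V\neq 0$ and no subspace other than $0$ and $V$ is stable under both $\beta$ and $\rho$; two representations are *equivalent* if a linear isomorphism intertwines both actions. Let $p>q$ be primes. Define operations on $\mathbb Z_p\times\mathbb Z_q$ as follows, where $g\in\mathbb Z_p$ is a fixed element of multiplicative order $q$ (it exists if and only if $p\equiv 1 \bmod q$, and is needed for all of these braces but $B$): - $B$: $(n,m)\cdot(s,t)=(n,m)\circ(s,t)=(n+s,m+t)$. - $C$: $(n,m)\cdot(s,t)=(n+s,m+t)$ and $(n,m)\circ(s,t)=(n+g^ms,m+t)$.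 - $D$, $E$, $F_\gamma$ $(1<\gamma\le q)$, $G_\mu$ $(1<\mu\le q)$ all have $(n,m)\cdot(s,t)=(n+g^ms,m+t)$, and $(n,m)\circ(s,t)$ equal to $(n+g^ms,m+t)$ for $D$, $(g^tn+g^ms,m+t)$ for $E$, $(n+(g^\gamma)^ms,m+t)$ for $F_\gamma$, and $(g^tn+(g^\mu)^ms,m+t)$ for $G_\mu$. **Theorem.** Let $A$ be a skew left brace of size $pq$, where $p>q$ are primes. Up to equivalence, the irreducible complex representations of $A$ are as follows. If $p\not\equiv 1 \bmod q$, then $A$ has exactly $p^2q^2$ irreducible representations of dimension $1$ and no others. If $p\equiv 1 \bmod q$, then: 1. if $A\cong B$, there are exactly $p^2q^2$ of dimension $1$ and no others; 2. if $A\cong C$, there are exactly $q^2$ of dimension $1$, exactly $p^2-1$ of dimension $q$, and no others; 3. if $A\cong D$, or $A\cong F_\gamma$ for some $1<\gamma<q$, or $A\cong G_\mu$ for some $1<\mu\le q$, there are exactly $q^2$ of dimension $1$, exactly $2(p-1)$ of dimension $q$, exactly $(p-1)^2/q^2$ of dimension $q^2$, and no others; 4. if $A\cong E$ or $A\cong F_q$,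 there are exactly $pq^2$ of dimension $1$, exactly $p^2-p$ of dimension $q$, and no others. -/

import Mathlib

universe u v

/-- A skew left brace on `A`: two group structures, `(A, ·)` (`dot`, the additive group) and
`(A, ∘)` (`circ`, the multiplicative group), with `a ∘ (b · c) = (a ∘ b) · a⁻¹ · (a ∘ c)`,
the inverse being taken in `(A, ·)`. -/
structure SkewLeftBrace (A : Type*) where
  dot : Group A
  circ : Group A
  compat : ∀ a b c : A,
    circ.mul a (dot.mul b c) = dot.mul (dot.mul (circ.mul a b) (dot.inv a)) (circ.mul a c)

namespace SkewLeftBrace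

/-- The carrier of `S`, regarded as the additive group `(A, ·)`. -/
def Dot {A : Type*} (_S : SkewLeftBrace A) : Type _ := A

/-- The carrier of `S`, regarded as the multiplicative group `(A, ∘)`. -/
def Circ {A : Type*} (_S : SkewLeftBrace A) : Type _ := A

instance {A : Type*} (S : SkewLeftBrace A) : Group S.Dot := S.dot

instance {A : Type*} (S : SkewLeftBrace A) : Group S.Circ := S.circ

/-- The map `λᵒᵖ_a(b) = (a ∘ b) · a⁻¹` of the opposite skew left brace. -/
def lambdaOp {A : Type*} (S : SkewLeftBrace A) (a : S.Circ) (b : S.Dot) : S.Dot :=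
  S.dot.mul (S.circ.mul a b) (S.dot.inv a)

/-- Isomorphism of skew left braces: a bijection respecting both operations. -/
def IsIso {A B : Type*} (S : SkewLeftBrace A) (T : SkewLeftBrace B) : Prop :=
  ∃ f : A ≃ B, (∀ a b : A, f (S.dot.mul a b) = T.dot.mul (f a) (f b)) ∧
    (∀ a b : A, f (S.circ.mul a b) = T.circ.mul (f a) (f b))

/-- A representation of the skew left brace `S` on the `k`-vector space `V`: a representation
`β` of `(A, ·)` and a representation `ρ` of `(A, ∘)` on `V` such that
`β (λᵒᵖ_a(b)) = ρ(a) β(b) ρ(a)⁻¹` for all `a, b`. -/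
structure Rep {A : Type*} (S : SkewLeftBrace A) (k V : Type*) [Field k] [AddCommGroup V]
    [Module k V] where
  β : Representation k S.Dot V
  ρ : Representation k S.Circ V
  compat : ∀ (a : S.Circ) (b : S.Dot), β (S.lambdaOp a b) = ρ a * β b * ρ a⁻¹

/-- A representation of a skew left brace is irreducible if it is nonzero and `0` and `V` are
the only subspaces stable under both `β` and `ρ`. -/
def Rep.IsIrreducible {A : Type*} {S : SkewLeftBrace A} {k V : Type*} [Field k]
    [AddCommGroup V] [Module k V] (R : S.Rep k V) : Prop :=
  Nontrivial V ∧ ∀ W : Submodule k V, (∀ a, ∀ v ∈ W, R.β a v ∈ W) →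
    (∀ a, ∀ v ∈ W, R.ρ a v ∈ W) → W = ⊥ ∨ W = ⊤

/-- Equivalence of representations of a skew left brace: a linear isomorphism intertwining
both actions. -/
def Rep.IsEquiv {A : Type*} {S : SkewLeftBrace A} {k V W : Type*} [Field k]
    [AddCommGroup V] [Module k V] [AddCommGroup W] [Module k W]
    (R : S.Rep k V) (R' : S.Rep k W) : Prop :=
  ∃ f : V ≃ₗ[k] W, (∀ a v, f (R.β a v) = R'.β a (f v)) ∧ (∀ a v, f (R.ρ a v) = R'.ρ a (f v))

/-- Equivalence, as a relation on the `d`-dimensional irreducible complex representations, all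
realized on `ℂ ^ d`. -/
def irrSetoid {A : Type*} (S : SkewLeftBrace A) (d : ℕ) :
    Setoid {R : S.Rep ℂ (Fin d → ℂ) // R.IsIrreducible} where
  r R R' := R.1.IsEquiv R'.1
  iseqv :=
    { refl := fun _ => ⟨LinearEquiv.refl ℂ _, fun _ _ => rfl, fun _ _ => rfl⟩
      symm := fun ⟨f, h₁, h₂⟩ => ⟨f.symm,
        fun a v => f.injective (by rw [h₁]; simp),
        fun a v => f.injective (by rw [h₂]; simp)⟩
      trans := fun ⟨f, h₁, h₂⟩ ⟨e, k₁, k₂⟩ => ⟨f.trans e,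
        fun a v => by simp [h₁, k₁], fun a v => by simp [h₂, k₂]⟩ }

/-- The number, possibly infinite, of equivalence classes of `d`-dimensional irreducible complex
representations of `S`. -/
noncomputable def numIrr {A : Type*} (S : SkewLeftBrace A) (d : ℕ) : ℕ∞ :=
  ENat.card (Quotient (S.irrSetoid d))

/-- Every irreducible complex representation of `S`, on an arbitrary complex vector space, is
finite-dimensional with dimension in `D`. -/
def IrrDimsIn {A : Type u} (S : SkewLeftBrace A) (D : Set ℕ) : Prop :=
  ∀ (V : Type v) [AddCommGroup V] [Module ℂ V] (R : S.Rep ℂ V), R.IsIrreducible →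
    FiniteDimensional ℂ V ∧ Module.finrank ℂ V ∈ D

end SkewLeftBrace

namespace PQBrace

/-- `u ^ m` for a unit `u` of `ℤ/p` with `u ^ q = 1` and an exponent `m` in `ℤ/q`. -/
def zpw {p q : ℕ} (u : (ZMod p)ˣ) (m : ZMod q) : ZMod p := ((u ^ m.val : (ZMod p)ˣ) : ZMod p)

theorem zpw_zero {p q : ℕ} (u : (ZMod p)ˣ) : zpw u (0 : ZMod q) = 1 := by
  simp [zpw]

theorem zpw_add {p q : ℕ} [NeZero q] {u : (ZMod p)ˣ} (hu : u ^ q = 1) (m t : ZMod q) :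
    zpw u (m + t) = zpw u m * zpw u t := by
  rw [zpw, zpw, zpw, ZMod.val_add, ← Units.val_mul, ← pow_add, ← pow_mod_orderOf,
    Nat.mod_mod_of_dvd _ (orderOf_dvd_of_pow_eq_one hu), pow_mod_orderOf]

theorem zpw_mul_neg {p q : ℕ} [NeZero q] {u : (ZMod p)ˣ} (hu : u ^ q = 1) (m : ZMod q) :
    zpw u m * zpw u (-m) = 1 := by
  rw [← zpw_add hu, add_neg_cancel, zpw_zero]

/-- The group on `ℤ/p × ℤ/q` with `(n, m) * (s, t) = (a ^ t * n + b ^ m * s, m + t)`, for units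
`a, b` of `ℤ/p` with `a ^ q = b ^ q = 1`. -/
@[reducible] def grp {p q : ℕ} [NeZero q] (a b : (ZMod p)ˣ) (ha : a ^ q = 1) (hb : b ^ q = 1) :
    Group (ZMod p × ZMod q) :=
  letI : Mul (ZMod p × ZMod q) :=
    ⟨fun x y => (zpw a y.2 * x.1 + zpw b x.2 * y.1, x.2 + y.2)⟩
  letI : One (ZMod p × ZMod q) := ⟨(0, 0)⟩
  letI : Inv (ZMod p × ZMod q) := ⟨fun x => (-(zpw a (-x.2) * zpw b (-x.2) * x.1), -x.2)⟩
  Group.ofLeftAxioms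
    (by
      rintro ⟨n, m⟩ ⟨s, t⟩ ⟨u, v⟩
      refine Prod.ext ?_ (add_assoc m t v)
      change zpw a v * (zpw a t * n + zpw b m * s) + zpw b (m + t) * u =
        zpw a (t + v) * n + zpw b m * (zpw a v * s + zpw b t * u)
      rw [zpw_add ha, zpw_add hb]
      ring)
    (by
      rintro ⟨n, m⟩
      refine Prod.ext ?_ (zero_add m)
      change zpw a m * 0 + zpw b (0 : ZMod q) * n = n
      rw [zpw_zero]
      ring)
    (by
      rintro ⟨n, m⟩
      refine Prod.ext ?_ (neg_add_cancel m)
      change zpw a m * (-(zpw a (-m) * zpw b (-m) * n)) + zpw b (-m) * n = 0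
      linear_combination (-(zpw b (-m) * n)) * zpw_mul_neg ha m)

/-- The skew left brace on `ℤ/p × ℤ/q` with
`(n, m) · (s, t) = (n + c ^ m * s, m + t)` and `(n, m) ∘ (s, t) = (a ^ t * n + b ^ m * s, m + t)`,
where `a` is `1` or `c`. -/
def mk {p q : ℕ} [NeZero q] (c a b : (ZMod p)ˣ) (hc : c ^ q = 1) (ha : a ^ q = 1)
    (hb : b ^ q = 1) (hac : a = 1 ∨ a = c) : SkewLeftBrace (ZMod p × ZMod q) where
  dot := grp 1 c (one_pow q) hc
  circ := grp a b ha hb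
  compat := by
    have h1 : ∀ m : ZMod q, zpw (1 : (ZMod p)ˣ) m = 1 := fun m => by simp [zpw]
    rintro ⟨n, m⟩ ⟨s, t⟩ ⟨u, v⟩
    refine Prod.ext ?_ ?_
    · change zpw a (t + v) * n + zpw b m * (zpw 1 v * s + zpw c t * u) =
        zpw 1 (m + v) * (zpw 1 (-m) * (zpw a t * n + zpw b m * s) +
          zpw c (m + t) * (-(zpw 1 (-m) * zpw c (-m) * n))) +
          zpw c (m + t + -m) * (zpw a v * n + zpw b m * u)
      have e : m + t + -m = t := by abel
      rw [e]
      have h2 := zpw_mul_neg hc m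
      rcases hac with rfl | rfl
      · simp only [h1, zpw_add hc]
        linear_combination (zpw c t * n) * h2
      · simp only [h1, zpw_add hc]
        linear_combination (zpw a t * n) * h2
    · change m + (t + v) = m + t + -m + (m + v)
      abel

theorem pow_pow_one {p q : ℕ} {g : (ZMod p)ˣ} (hg : orderOf g = q) (j : ℕ) :
    (g ^ j) ^ q = 1 := by
  rw [← pow_mul, mul_comm, pow_mul, ← hg, pow_orderOf_eq_one, one_pow]

theorem pow_one {p q : ℕ} {g : (ZMod p)ˣ} (hg : orderOf g = q) : g ^ q = 1 := by
  rw [← hg, pow_orderOf_eq_one]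

/-- `B`: both operations are `(n + s, m + t)`. -/
def B (p q : ℕ) [NeZero q] : SkewLeftBrace (ZMod p × ZMod q) :=
  mk 1 1 1 (one_pow q) (one_pow q) (one_pow q) (Or.inl rfl)

/-- `C`: `(n, m) · (s, t) = (n + s, m + t)` and `(n, m) ∘ (s, t) = (n + g ^ m * s, m + t)`. -/
def C {p q : ℕ} [NeZero q] (g : (ZMod p)ˣ) (hg : orderOf g = q) :
    SkewLeftBrace (ZMod p × ZMod q) :=
  mk 1 1 g (one_pow q) (one_pow q) (pow_one hg) (Or.inl rfl)

/-- `D`: both operations are `(n + g ^ m * s, m + t)`. -/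
def D {p q : ℕ} [NeZero q] (g : (ZMod p)ˣ) (hg : orderOf g = q) :
    SkewLeftBrace (ZMod p × ZMod q) :=
  mk g 1 g (pow_one hg) (one_pow q) (pow_one hg) (Or.inl rfl)

/-- `E`: `(n, m) · (s, t) = (n + g ^ m * s, m + t)` and
`(n, m) ∘ (s, t) = (g ^ t * n + g ^ m * s, m + t)`. -/
def E {p q : ℕ} [NeZero q] (g : (ZMod p)ˣ) (hg : orderOf g = q) :
    SkewLeftBrace (ZMod p × ZMod q) :=
  mk g g g (pow_one hg) (pow_one hg) (pow_one hg) (Or.inr rfl)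

/-- `F_γ`: `(n, m) · (s, t) = (n + g ^ m * s, m + t)` and
`(n, m) ∘ (s, t) = (n + (g ^ γ) ^ m * s, m + t)`. -/
def F {p q : ℕ} [NeZero q] (g : (ZMod p)ˣ) (hg : orderOf g = q) (γ : ℕ) :
    SkewLeftBrace (ZMod p × ZMod q) :=
  mk g 1 (g ^ γ) (pow_one hg) (one_pow q) (pow_pow_one hg γ) (Or.inl rfl)

/-- `G_μ`: `(n, m) · (s, t) = (n + g ^ m * s, m + t)` and
`(n, m) ∘ (s, t) = (g ^ t * n + (g ^ μ) ^ m * s, m + t)`. -/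
def G {p q : ℕ} [NeZero q] (g : (ZMod p)ˣ) (hg : orderOf g = q) (μ : ℕ) :
    SkewLeftBrace (ZMod p × ZMod q) :=
  mk g g (g ^ μ) (pow_one hg) (pow_one hg) (pow_pow_one hg μ) (Or.inr rfl)

end PQBrace

/-! The compatibility condition says exactly that `β` and `ρ` combine into a representation of the
semidirect product of `(A, ·)` by `(A, ∘)` acting through `lambdaOp` (`repEquiv`), so the task is to
classify the irreducible representations of a finite group.

For every brace `mk c a b` a change of coordinates turns this group into `(ℤ/p)² ⋊ (ℤ/q)²`, with
`(ℤ/q)²` acting diagonally through the two characters `fstChar` and `sndChar`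
(`nonempty_semiProd_mk_mulEquiv`). Both factors are abelian, so the method of little groups applies.
An irreducible representation of `N ⋊ Q` is determined by a `Q`-orbit of characters `χ` of `N` and a
character of the stabilizer of `χ`, and its dimension is the size `d` of the orbit. Since `Q` is
abelian, the character of the stabilizer extends to some `ψ` on `Q`, in `d` ways. Each class
therefore comes from `d ^ 2` pairs `(χ, ψ)`, which gives the counting formula `card_irr_mul_sq`.

It remains to count orbits (`card_chars_diagAct`). A character of `(ℤ/p)²` is a pair, and its orbit
size is the order of the image of those acting characters that belong to its nontrivial components.
The cases of the theorem differ in whether `sndChar` is trivial and in whether the two acting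
characters are independent.

If `p ≢ 1 mod q`, groups of order `pq` are cyclic with automorphism group of order prime to `pq`.
The action is then trivial and the semidirect product is abelian of order `(pq)²`. The brace `B`
behaves in the same way. -/

namespace GroupRep

/-! ### Irreducibility, equivalence and Schur's lemma. -/

variable {Γ Δ V W U : Type*} [Group Γ] [Group Δ] [AddCommGroup V] [Module ℂ V] [AddCommGroup W]
  [Module ℂ W] [AddCommGroup U] [Module ℂ U]

/-- A representation is irreducible if it is nonzero and has no proper nonzero stable subspace. -/
def IsIrr (R : Representation ℂ Γ V) : Prop :=
  Nontrivial V ∧ ∀ W : Submodule ℂ V, (∀ g, ∀ v ∈ W, R g v ∈ W) → W = ⊥ ∨ W = ⊤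

/-- Equivalence of representations. -/
def Equivalent (R : Representation ℂ Γ V) (R' : Representation ℂ Γ W) : Prop :=
  ∃ f : V ≃ₗ[ℂ] W, ∀ g v, f (R g v) = R' g (f v)

theorem Equivalent.refl (R : Representation ℂ Γ V) : Equivalent R R :=
  ⟨LinearEquiv.refl ℂ _, fun _ _ => rfl⟩

theorem Equivalent.symm {R : Representation ℂ Γ V} {R' : Representation ℂ Γ W}
    (h : Equivalent R R') : Equivalent R' R := by
  obtain ⟨f, hf⟩ := h
  exact ⟨f.symm, fun g v => f.injective (by rw [hf]; simp)⟩

theorem Equivalent.trans {R : Representation ℂ Γ V} {R' : Representation ℂ Γ W}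
    {R'' : Representation ℂ Γ U} (h : Equivalent R R') (h' : Equivalent R' R'') :
    Equivalent R R'' := by
  obtain ⟨f, hf⟩ := h
  obtain ⟨e, he⟩ := h'
  exact ⟨f.trans e, fun g v => by simp [hf, he]⟩

theorem Equivalent.isIrr {R : Representation ℂ Γ V} {R' : Representation ℂ Γ W}
    (h : Equivalent R R') (hR : IsIrr R) : IsIrr R' := by
  obtain ⟨f, hf⟩ := h
  have := hR.1
  refine ⟨f.symm.toEquiv.nontrivial, fun X hX => ?_⟩
  rcases hR.2 (X.comap f.toLinearMap) (fun g v hv => by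
    simpa [hf] using hX g _ hv) with h | h
  · left
    rw [eq_bot_iff]
    intro x hx
    have : f.symm x ∈ X.comap f.toLinearMap := by simpa using hx
    rw [h] at this
    simpa using this
  · right
    rw [eq_top_iff]
    intro x _
    have : f.symm x ∈ X.comap f.toLinearMap := h ▸ Submodule.mem_top
    simpa using this

/-- Schur's lemma: a nonzero intertwiner of irreducible representations is an equivalence. -/
theorem equivalent_of_intertwiner {R : Representation ℂ Γ V} {R' : Representation ℂ Γ W}
    (hR : IsIrr R) (hR' : IsIrr R') (T : V →ₗ[ℂ] W) (hT : ∀ g v, T (R g v) = R' g (T v))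
    (h0 : T ≠ 0) : Equivalent R R' := by
  refine ⟨LinearEquiv.ofBijective T ⟨?_, ?_⟩, hT⟩
  · rcases hR.2 (LinearMap.ker T) (fun g v hv => by
      rw [LinearMap.mem_ker] at hv ⊢
      rw [hT, hv, map_zero]) with h | h
    · exact LinearMap.ker_eq_bot.1 h
    · exact absurd (LinearMap.ker_eq_top.1 h) h0
  · rcases hR'.2 (LinearMap.range T) (by
      rintro g _ ⟨v, rfl⟩
      exact ⟨R g v, hT g v⟩) with h | h
    · exact absurd (LinearMap.range_eq_bot.1 h) h0
    · exact LinearMap.range_eq_top.1 h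

/-- Equivalence as a relation on the irreducible representations on `ℂ ^ d`. -/
def irrSetoid (Γ : Type*) [Group Γ] (d : ℕ) :
    Setoid {R : Representation ℂ Γ (Fin d → ℂ) // IsIrr R} where
  r R R' := Equivalent R.1 R'.1
  iseqv := ⟨fun _ => Equivalent.refl _, Equivalent.symm, Equivalent.trans⟩

/-- An irreducible representation of dimension `d` has an equivalent copy on `ℂ ^ d`. -/
theorem exists_equivalent_fin {R : Representation ℂ Γ V} (hR : IsIrr R) {d : ℕ}
    (e : V ≃ₗ[ℂ] (Fin d → ℂ)) :
    ∃ R' : {R : Representation ℂ Γ (Fin d → ℂ) // IsIrr R}, Equivalent R R'.1 := by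
  let R' : Representation ℂ Γ (Fin d → ℂ) :=
    { toFun := fun g => e.toLinearMap ∘ₗ R g ∘ₗ e.symm.toLinearMap
      map_one' := by ext; simp
      map_mul' := fun g h => by ext; simp }
  have h : Equivalent R R' := ⟨e, fun g v => by simp [R']⟩
  exact ⟨⟨R', h.isIrr hR⟩, h⟩

/-! ### Characters of finite abelian groups and common eigenvectors. -/

section Abelian

variable {H : Type*} [CommGroup H]

theorem sum_char_eq_zero [Fintype H] {χ : H →* ℂˣ} (h : χ ≠ 1) : ∑ x, (χ x : ℂ) = 0 := by
  refine sum_hom_units_eq_zero ((Units.coeHom ℂ).comp χ) fun h' => h ?_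
  ext x
  simpa using DFunLike.congr_fun h' x

variable [Finite H]

instance finite_dual : Finite (H →* ℂˣ) :=
  Finite.of_equiv H (CommGroup.monoidHom_mulEquiv_of_hasEnoughRootsOfUnity H ℂ).some.symm.toEquiv

theorem sum_dual_eq_zero [Fintype (H →* ℂˣ)] {x : H} (h : x ≠ 1) :
    ∑ χ : H →* ℂˣ, (χ x : ℂ) = 0 := by
  refine sum_hom_units_eq_zero ((Units.coeHom ℂ).comp (MonoidHom.eval x)) fun h' => ?_
  obtain ⟨χ, hχ⟩ := CommGroup.exists_apply_ne_one_of_hasEnoughRootsOfUnity H ℂ h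
  exact hχ (Units.ext (by simpa using DFunLike.congr_fun h' χ))

/-- A stable nonzero subspace of a representation of a finite abelian group contains a common
eigenvector. -/
theorem exists_eigenvector (R : Representation ℂ H V) (X : Submodule ℂ V) (hX : X ≠ ⊥)
    (hs : ∀ g, ∀ v ∈ X, R g v ∈ X) :
    ∃ (χ : H →* ℂˣ) (v : V), v ∈ X ∧ v ≠ 0 ∧ ∀ g, R g v = (χ g : ℂ) • v := by
  classical
  have := Fintype.ofFinite H
  have := Fintype.ofFinite (H →* ℂˣ)
  obtain ⟨w, hw, hw0⟩ := Submodule.exists_mem_ne_zero_of_ne_bot hX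
  -- Up to the factor `|H|`, `e χ` is the projection of `w` to the `χ`-eigenspace. The projections
  -- add up to a nonzero multiple of `w`, so one of them is nonzero; no finiteness of `V` is needed.
  let e (χ : H →* ℂˣ) : V := ∑ g, (χ g⁻¹ : ℂ) • R g w
  have hsum : ∑ χ, e χ = (Fintype.card (H →* ℂˣ) : ℂ) • w := by
    simp only [e]
    rw [Finset.sum_comm, Finset.sum_eq_single 1]
    · simp [Nat.cast_smul_eq_nsmul]
    · intro g _ hg
      rw [← Finset.sum_smul, sum_dual_eq_zero (inv_ne_one.2 hg), zero_smul]
    · simp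
  obtain ⟨χ, hχ⟩ : ∃ χ, e χ ≠ 0 := by
    by_contra! h
    simp only [h, Finset.sum_const_zero] at hsum
    exact smul_ne_zero (Nat.cast_ne_zero.2 Fintype.card_ne_zero) hw0 hsum.symm
  refine ⟨χ, e χ, X.sum_mem fun g _ => X.smul_mem _ (hs g w hw), hχ, fun g => ?_⟩
  simp only [e, map_sum, map_smul, Finset.smul_sum, smul_smul]
  refine Fintype.sum_equiv (Equiv.mulLeft g) _ _ fun x => ?_
  simp only [Equiv.coe_mulLeft, map_mul, Module.End.mul_apply, mul_inv_rev, Units.val_mul]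
  congr 1
  rw [map_inv χ g, mul_comm (χ x⁻¹ : ℂ), ← mul_assoc, ← Units.val_mul, mul_inv_cancel,
    Units.val_one, one_mul]

end Abelian

end GroupRep

/-! ### Little groups: irreducible representations of `N ⋊ Q` with `N` and `Q` abelian. -/

namespace GroupRep

open MulAction

variable {N Q : Type*} [CommGroup N] [CommGroup Q]

/-- The complex characters of `N`, on which `Q` acts through `φ`. -/
def Chars (_φ : Q →* MulAut N) : Type _ := N →* ℂˣ

variable (φ : Q →* MulAut N)

instance : CommGroup (Chars φ) := inferInstanceAs (CommGroup (N →* ℂˣ))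

instance : FunLike (Chars φ) N ℂˣ := inferInstanceAs (FunLike (N →* ℂˣ) N ℂˣ)

instance : MonoidHomClass (Chars φ) N ℂˣ := inferInstanceAs (MonoidHomClass (N →* ℂˣ) N ℂˣ)

instance [Finite N] : Finite (Chars φ) := inferInstanceAs (Finite (N →* ℂˣ))

instance : MulAction Q (Chars φ) where
  smul x χ := MonoidHom.comp (χ : N →* ℂˣ) (φ x⁻¹).toMonoidHom
  one_smul χ := by
    refine DFunLike.ext _ _ fun n => ?_
    change (χ : N →* ℂˣ) (φ 1⁻¹ n) = χ n
    rw [inv_one, map_one]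
    rfl
  mul_smul x y χ := by
    refine DFunLike.ext _ _ fun n => ?_
    change (χ : N →* ℂˣ) (φ (x * y)⁻¹ n) = (χ : N →* ℂˣ) (φ y⁻¹ (φ x⁻¹ n))
    rw [mul_inv_rev, map_mul, MulAut.mul_apply]

theorem smul_char_apply (x : Q) (χ : Chars φ) (n : N) : (x • χ) n = χ (φ x⁻¹ n) := rfl

variable {φ}

/-- The representation of `N ⋊ Q` on the functions on the orbit of `χ`, where `N` acts on the
coordinate `η` by `η` and `Q` permutes the coordinates and acts by `ψ`. -/
def orbitRep (χ : Chars φ) (ψ : Q →* ℂˣ) : Representation ℂ (N ⋊[φ] Q) (orbit Q χ → ℂ) where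
  toFun g :=
    { toFun := fun f η => (η.1 g.left : ℂ) * ((ψ g.right : ℂ) * f (g.right⁻¹ • η))
      map_add' := fun f f' => by ext; simp [mul_add]
      map_smul' := fun c f => by ext; simp; ring }
  map_one' := by
    refine LinearMap.ext fun f => funext fun η => ?_
    simp
  map_mul' g h := by
    refine LinearMap.ext fun f => funext fun η => ?_
    simp only [SemidirectProduct.mul_left, SemidirectProduct.mul_right, map_mul, Units.val_mul,
      LinearMap.coe_mk, AddHom.coe_mk, Module.End.mul_apply, mul_inv_rev, mul_smul, orbit.coe_smul,
      smul_char_apply, inv_inv]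
    rw [smul_comm]
    ring

theorem orbitRep_apply (χ : Chars φ) (ψ : Q →* ℂˣ) (g : N ⋊[φ] Q) (f : orbit Q χ → ℂ)
    (η : orbit Q χ) :
    orbitRep χ ψ g f η = (η.1 g.left : ℂ) * ((ψ g.right : ℂ) * f (g.right⁻¹ • η)) := rfl

theorem sum_chars_eq [Fintype N] (χ η : Chars φ) [Decidable (χ = η)] :
    ∑ n, (χ n⁻¹ : ℂ) * (η n : ℂ) = if χ = η then (Fintype.card N : ℂ) else 0 := by
  split_ifs with h
  · subst h
    simp
  · rw [← sum_char_eq_zero (χ := (χ⁻¹ * η : N →* ℂˣ))]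
    · refine Finset.sum_congr rfl fun n _ => ?_
      rw [← Units.val_mul, map_inv]
      rfl
    · exact fun h' => h (inv_mul_eq_one.1 h')

/-- Dividing by `ψ` leaves the characters of `Q` trivial on the stabilizer. They are the characters
of the quotient, hence as many as its index, which is the orbit size. -/
theorem card_eq_on_stabilizer [Finite Q] (χ : Chars φ) (ψ : Q →* ℂˣ) :
    Nat.card {ψ' : Q →* ℂˣ // ∀ x ∈ stabilizer Q χ, ψ' x = ψ x} = Nat.card (orbit Q χ) := by
  rw [Nat.card_congr (orbitEquivQuotientStabilizer Q χ),
    ← CommGroup.card_domRestrictHom_ker ℂ (stabilizer Q χ)]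
  refine Nat.card_congr ((Equiv.mulLeft ψ⁻¹).subtypeEquiv fun ψ' => ?_)
  rw [MonoidHom.mem_ker, MonoidHom.domRestrictHom_apply, MonoidHom.domRestrict_eq_one_iff]
  simp only [Equiv.coe_mulLeft, MonoidHom.mul_apply, MonoidHom.inv_apply, inv_mul_eq_one]
  exact forall₂_congr fun _ _ => eq_comm

variable [Finite N]

/-- The coordinates carry pairwise distinct characters of `N`, so averaging over `N` isolates one
coordinate of a nonzero vector; `Q` then moves it to all the others. -/
theorem orbitRep_isIrr (χ : Chars φ) (ψ : Q →* ℂˣ) : IsIrr (orbitRep χ ψ) := by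
  classical
  have := Fintype.ofFinite N
  have := Fintype.ofFinite (orbit Q χ)
  have : Nonempty (orbit Q χ) := ⟨⟨χ, mem_orbit_self χ⟩⟩
  refine ⟨Function.nontrivial, fun X hX => ?_⟩
  rw [or_iff_not_imp_left]
  intro hX0
  obtain ⟨f, hf, hf0⟩ := Submodule.exists_mem_ne_zero_of_ne_bot hX0
  obtain ⟨η, hη⟩ := Function.ne_iff.1 hf0
  have key : Pi.single η (1 : ℂ) ∈ X := by
    have h : ∑ n, (η.1 n⁻¹ : ℂ) • orbitRep χ ψ (SemidirectProduct.inl n) f ∈ X :=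
      X.sum_mem fun n _ => X.smul_mem _ (hX _ _ hf)
    have e : ∑ n, (η.1 n⁻¹ : ℂ) • orbitRep χ ψ (SemidirectProduct.inl n) f =
        ((Fintype.card N : ℂ) * f η) • Pi.single η (1 : ℂ) := by
      ext ζ
      simp only [Finset.sum_apply, Pi.smul_apply, orbitRep_apply, SemidirectProduct.left_inl,
        SemidirectProduct.right_inl, map_one, Units.val_one, one_mul, inv_one, one_smul,
        smul_eq_mul, ← mul_assoc]
      rw [← Finset.sum_mul, sum_chars_eq]
      by_cases h : η = ζ
      · subst h; simp
      · simp [Subtype.val_injective.ne h, Ne.symm h]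
    rw [e] at h
    exact (X.smul_mem_iff (mul_ne_zero (Nat.cast_ne_zero.2 Fintype.card_ne_zero) hη)).1 h
  have all : ∀ ζ : orbit Q χ, Pi.single ζ (1 : ℂ) ∈ X := fun ζ => by
    obtain ⟨x, rfl⟩ := exists_smul_eq Q η ζ
    have h := hX (SemidirectProduct.inr x) _ key
    have e : orbitRep χ ψ (SemidirectProduct.inr x) (Pi.single η (1 : ℂ)) =
        (ψ x : ℂ) • Pi.single (x • η) (1 : ℂ) := by
      ext ζ
      simp only [orbitRep_apply, SemidirectProduct.left_inr, SemidirectProduct.right_inr, map_one,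
        Units.val_one, one_mul, Pi.smul_apply, smul_eq_mul, Pi.single_apply, inv_smul_eq_iff]
    rw [e] at h
    exact (X.smul_mem_iff (ψ x).ne_zero).1 h
  rw [eq_top_iff]
  intro f _
  rw [pi_eq_sum_univ' f]
  exact X.sum_mem fun ζ _ => X.smul_mem _ (by
    convert all ζ using 1)

variable [Finite Q]

/-- An irreducible representation with an eigenvector for `N` of character `χ` on which the
stabilizer of `χ` acts by `ψ` is equivalent to `orbitRep χ ψ`. -/
theorem equivalent_of_eigenvector {V : Type*} [AddCommGroup V] [Module ℂ V]
    {R : Representation ℂ (N ⋊[φ] Q) V} (hR : IsIrr R) (χ : Chars φ) (ψ : Q →* ℂˣ) {v : V}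
    (hv : v ≠ 0) (hχ : ∀ n, R (SemidirectProduct.inl n) v = (χ n : ℂ) • v)
    (hψ : ∀ x ∈ stabilizer Q χ, R (SemidirectProduct.inr x) v = (ψ x : ℂ) • v) :
    Equivalent (orbitRep χ ψ) R := by
  classical
  have := Fintype.ofFinite Q
  -- This is the intertwiner induced from `v`: it sends the basis vector at `χ` to `v` times the
  -- order of the stabilizer, and in particular is nonzero.
  let T : (orbit Q χ → ℂ) →ₗ[ℂ] V :=
    { toFun := fun f => ∑ x : Q,
        (f ⟨x • χ, mem_orbit χ x⟩ * (ψ x⁻¹ : ℂ)) • R (SemidirectProduct.inr x) v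
      map_add' := fun f f' => by simp [add_mul, add_smul, Finset.sum_add_distrib]
      map_smul' := fun c f => by simp [Finset.smul_sum, smul_smul, mul_assoc] }
  have hT : ∀ f, T f = ∑ x : Q,
      (f ⟨x • χ, mem_orbit χ x⟩ * (ψ x⁻¹ : ℂ)) • R (SemidirectProduct.inr x) v := fun _ => rfl
  have hinl : ∀ n f, T (orbitRep χ ψ (SemidirectProduct.inl n) f) =
      R (SemidirectProduct.inl n) (T f) := fun n f => by
    rw [hT, hT, map_sum]
    refine Finset.sum_congr rfl fun x _ => ?_
    have e : R (SemidirectProduct.inl n) (R (SemidirectProduct.inr x) v) =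
        ((x • χ) n : ℂ) • R (SemidirectProduct.inr x) v := by
      have h : (SemidirectProduct.inl n * SemidirectProduct.inr x : N ⋊[φ] Q) =
          SemidirectProduct.inr x * SemidirectProduct.inl (φ x⁻¹ n) := by
        ext <;> simp
      rw [← Module.End.mul_apply, ← map_mul, h, map_mul, Module.End.mul_apply, hχ, map_smul,
        smul_char_apply]
    rw [map_smul, e, smul_smul, orbitRep_apply]
    simp only [SemidirectProduct.left_inl, SemidirectProduct.right_inl, map_one, Units.val_one,
      one_mul, inv_one, one_smul]
    congr 1
    ring
  have hinr : ∀ y f, T (orbitRep χ ψ (SemidirectProduct.inr y) f) =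
      R (SemidirectProduct.inr y) (T f) := fun y f => by
    rw [hT, hT, map_sum]
    refine (Fintype.sum_equiv (Equiv.mulLeft y) _ _ fun x => ?_).symm
    rw [map_smul, ← Module.End.mul_apply, ← map_mul, ← map_mul, orbitRep_apply]
    simp only [SemidirectProduct.left_inr, SemidirectProduct.right_inr, map_one, Units.val_one,
      one_mul, Equiv.coe_mulLeft]
    congr 1
    have h1 : (y⁻¹ • ⟨(y * x) • χ, mem_orbit χ (y * x)⟩ : orbit Q χ) =
        ⟨x • χ, mem_orbit χ x⟩ := Subtype.ext (by simp [mul_smul])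
    have h2 : (ψ (y * x)⁻¹ : ℂ) * (ψ y : ℂ) = (ψ x⁻¹ : ℂ) := by
      rw [← Units.val_mul, ← map_mul]
      congr 2
      simp
    rw [h1, ← h2]
    ring
  refine equivalent_of_intertwiner (orbitRep_isIrr χ ψ) hR T (fun g f => ?_) fun h0 => ?_
  · rw [← SemidirectProduct.inl_left_mul_inr_right g, map_mul, map_mul, Module.End.mul_apply,
      Module.End.mul_apply, hinl, hinr]
  · have h := LinearMap.congr_fun h0 (Pi.single ⟨χ, mem_orbit_self χ⟩ 1)
    rw [hT, LinearMap.zero_apply] at h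
    have e : ∀ x : Q, ((Pi.single (⟨χ, mem_orbit_self χ⟩ : orbit Q χ) (1 : ℂ) : orbit Q χ → ℂ)
        ⟨x • χ, mem_orbit χ x⟩ * (ψ x⁻¹ : ℂ)) • R (SemidirectProduct.inr x) v =
        if x ∈ stabilizer Q χ then v else 0 := fun x => by
      simp only [Pi.single_apply, Subtype.mk.injEq, ← mem_stabilizer_iff]
      split_ifs with hx
      · rw [hψ x hx, smul_smul, one_mul, ← Units.val_mul, ← map_mul]
        simp
      · simp
    simp only [e, ← Finset.sum_filter, Finset.sum_const] at h
    rw [← Nat.cast_smul_eq_nsmul ℂ] at h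
    refine smul_ne_zero (Nat.cast_ne_zero.2 (Finset.card_pos.2 ⟨1, ?_⟩).ne') hv h
    simp

/-- The basis vector at `χ` is an `N`-eigenvector of character `χ` on which the stabilizer acts by
`ψ`. An equivalence transports these data, and conversely they determine the representation by
`equivalent_of_eigenvector`. -/
theorem orbitRep_equivalent_iff (χ χ' : Chars φ) (ψ ψ' : Q →* ℂˣ) :
    Equivalent (orbitRep χ ψ) (orbitRep χ' ψ') ↔
      χ ∈ orbit Q χ' ∧ ∀ x ∈ stabilizer Q χ, ψ x = ψ' x := by
  classical
  constructor
  · rintro ⟨f, hf⟩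
    let v : orbit Q χ → ℂ := Pi.single ⟨χ, mem_orbit_self χ⟩ 1
    have hv : f v ≠ 0 := by simp [v]
    obtain ⟨η, hη⟩ := Function.ne_iff.1 hv
    -- `f v` is an `N`-eigenvector of character `χ`, while `N` acts on the coordinate `η` by `η`; a
    -- nonzero coordinate forces the two to agree.
    have h1 : η.1 = χ := by
      refine DFunLike.ext _ _ fun n => Units.ext ?_
      have h := congr_fun (hf (SemidirectProduct.inl n) v) η
      have e : orbitRep χ ψ (SemidirectProduct.inl n) v = (χ n : ℂ) • v := by
        ext ζ
        simp only [v, orbitRep_apply, SemidirectProduct.left_inl, SemidirectProduct.right_inl,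
          map_one, Units.val_one, one_mul, inv_one, one_smul, Pi.smul_apply, smul_eq_mul,
          Pi.single_apply]
        split_ifs with hζ
        · rw [hζ]
        · simp
      rw [e, map_smul, orbitRep_apply] at h
      simp only [SemidirectProduct.left_inl, SemidirectProduct.right_inl,
        map_one, Units.val_one, one_mul, inv_one, one_smul, Pi.smul_apply, smul_eq_mul] at h
      exact (mul_right_cancel₀ hη h).symm
    refine ⟨h1 ▸ η.2, fun x hx => Units.ext ?_⟩
    have h := congr_fun (hf (SemidirectProduct.inr x) v) η
    have e : orbitRep χ ψ (SemidirectProduct.inr x) v = (ψ x : ℂ) • v := by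
      ext ζ
      simp only [v, orbitRep_apply, SemidirectProduct.left_inr, SemidirectProduct.right_inr,
        map_one, Units.val_one, one_mul, Pi.smul_apply, smul_eq_mul, Pi.single_apply,
        inv_smul_eq_iff]
      congr 2
      rw [eq_iff_iff]
      have : x • (⟨χ, mem_orbit_self χ⟩ : orbit Q χ) = ⟨χ, mem_orbit_self χ⟩ :=
        Subtype.ext hx
      rw [this]
    have hx' : x⁻¹ • η = η := Subtype.ext (by
      rw [orbit.coe_smul, h1]
      exact inv_mem hx)
    rw [e, map_smul, orbitRep_apply] at h
    simp only [SemidirectProduct.left_inr, SemidirectProduct.right_inr, hx',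
      map_one, Units.val_one, one_mul, Pi.smul_apply, smul_eq_mul] at h
    exact mul_right_cancel₀ hη h
  · rintro ⟨h1, h2⟩
    refine equivalent_of_eigenvector (orbitRep_isIrr χ' ψ') χ ψ
      (v := Pi.single ⟨χ, h1⟩ 1) (by simp) (fun n => ?_) fun x hx => ?_
    · ext ζ
      simp only [orbitRep_apply, SemidirectProduct.left_inl, SemidirectProduct.right_inl,
        map_one, Units.val_one, one_mul, inv_one, one_smul, Pi.smul_apply, smul_eq_mul,
        Pi.single_apply]
      split_ifs with hζ
      · rw [hζ]
      · simp
    · ext ζ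
      simp only [orbitRep_apply, SemidirectProduct.left_inr, SemidirectProduct.right_inr,
        map_one, Units.val_one, one_mul, Pi.smul_apply, smul_eq_mul, Pi.single_apply,
        inv_smul_eq_iff, h2 x hx]
      have : x • (⟨χ, h1⟩ : orbit Q χ') = ⟨χ, h1⟩ := Subtype.ext hx
      rw [this]

theorem exists_equivalent_orbitRep {V : Type*} [AddCommGroup V] [Module ℂ V]
    {R : Representation ℂ (N ⋊[φ] Q) V} (hR : IsIrr R) :
    ∃ (χ : Chars φ) (ψ : Q →* ℂˣ), Equivalent (orbitRep χ ψ) R := by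
  have := hR.1
  obtain ⟨χ, w, -, hw0, hw⟩ := exists_eigenvector (R.comp SemidirectProduct.inl) ⊤ top_ne_bot
    fun _ _ _ => Submodule.mem_top
  let χ' : Chars φ := χ
  -- The whole `χ'`-eigenspace of `N`. It is stable under the stabilizer of `χ'`, an abelian group,
  -- which thus has an eigenvector inside it.
  let X : Submodule ℂ V := ⨅ n, LinearMap.ker
    (R (SemidirectProduct.inl n) - (χ' n : ℂ) • LinearMap.id)
  have hX : ∀ v, v ∈ X ↔ ∀ n, R (SemidirectProduct.inl n) v = (χ' n : ℂ) • v := fun v => by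
    simp [X, sub_eq_zero]
  obtain ⟨ψ₀, v, hvX, hv0, hv⟩ := exists_eigenvector
    ((R.comp SemidirectProduct.inr).comp (stabilizer Q χ').subtype) X
    (fun h => hw0 (by
      have : w ∈ X := (hX w).2 hw
      rwa [h, Submodule.mem_bot] at this))
    (by
      rintro ⟨x, hx⟩ v hv
      rw [hX] at hv ⊢
      intro n
      have h : (SemidirectProduct.inl n * SemidirectProduct.inr x : N ⋊[φ] Q) =
          SemidirectProduct.inr x * SemidirectProduct.inl (φ x⁻¹ n) := by
        ext <;> simp
      change R (SemidirectProduct.inl n) (R (SemidirectProduct.inr x) v) =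
        (χ' n : ℂ) • R (SemidirectProduct.inr x) v
      rw [← Module.End.mul_apply, ← map_mul, h, map_mul, Module.End.mul_apply, hv, map_smul,
        ← smul_char_apply, show x • χ' = χ' from hx])
  -- Characters of a subgroup of a finite abelian group extend to the group.
  obtain ⟨ψ, rfl⟩ := MonoidHom.domRestrict_surjective ℂ (stabilizer Q χ') ψ₀
  exact ⟨χ', ψ, equivalent_of_eigenvector hR χ' ψ hv0 ((hX v).1 hvX)
    fun x hx => hv ⟨x, hx⟩⟩

theorem finrank_mem_orbit_cards {V : Type*} [AddCommGroup V] [Module ℂ V]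
    {R : Representation ℂ (N ⋊[φ] Q) V} (hR : IsIrr R) :
    FiniteDimensional ℂ V ∧ ∃ χ : Chars φ, Module.finrank ℂ V = Nat.card (orbit Q χ) := by
  obtain ⟨χ, ψ, f, -⟩ := exists_equivalent_orbitRep hR
  have := Fintype.ofFinite (orbit Q χ)
  exact ⟨Module.Finite.equiv f, χ, by
    rw [← f.finrank_eq, Module.finrank_fintype_fun_eq_card, Nat.card_eq_fintype_card]⟩

/-- The number of irreducible representations of `N ⋊ Q` of dimension `d`, in terms of the number
of characters of `N` with an orbit of size `d`. -/
theorem card_irr_mul_sq (φ : Q →* MulAut N) (d : ℕ) :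
    Finite (Quotient (irrSetoid (N ⋊[φ] Q) d)) ∧
      Nat.card (Quotient (irrSetoid (N ⋊[φ] Q) d)) * d ^ 2 =
        Nat.card {χ : Chars φ // Nat.card (orbit Q χ) = d} * Nat.card Q := by
  classical
  let P := {χ : Chars φ // Nat.card (orbit Q χ) = d} × (Q →* ℂˣ)
  have hex : ∀ x : P, ∃ R' : {R : Representation ℂ (N ⋊[φ] Q) (Fin d → ℂ) // IsIrr R},
      Equivalent (orbitRep x.1.1 x.2) R'.1 := fun x =>
    exists_equivalent_fin (orbitRep_isIrr x.1.1 x.2) (LinearEquiv.funCongrLeft ℂ ℂ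
      (Finite.equivFinOfCardEq x.1.2).symm)
  choose F hF using hex
  let f : P → Quotient (irrSetoid (N ⋊[φ] Q) d) := fun x => Quotient.mk _ (F x)
  have hfeq : ∀ x y : P, f x = f y ↔
      x.1.1 ∈ orbit Q y.1.1 ∧ ∀ z ∈ stabilizer Q x.1.1, x.2 z = y.2 z := fun x y => by
    rw [← orbitRep_equivalent_iff, Quotient.eq]
    exact ⟨fun h => ((hF x).trans h).trans (hF y).symm,
      fun h => ((hF x).symm.trans h).trans (hF y)⟩
  have hsurj : Function.Surjective f := by
    intro c
    induction c using Quotient.inductionOn with | _ R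
    obtain ⟨χ, ψ, h⟩ := exists_equivalent_orbitRep R.2
    have hd : Nat.card (orbit Q χ) = d := by
      obtain ⟨e, -⟩ := h
      have := Fintype.ofFinite (orbit Q χ)
      simpa [Nat.card_eq_fintype_card] using e.finrank_eq
    exact ⟨(⟨χ, hd⟩, ψ), Quotient.sound ((hF (⟨χ, hd⟩, ψ)).symm.trans h)⟩
  have hfin : Finite (Quotient (irrSetoid (N ⋊[φ] Q) d)) := Finite.of_surjective f hsurj
  refine ⟨hfin, ?_⟩
  -- A fibre consists of `d` choices of `χ` in the orbit and, for each, `d` choices of `ψ` with the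
  -- prescribed restriction to the stabilizer.
  have hfib : ∀ c, Nat.card {x : P // f x = c} = d ^ 2 := by
    intro c
    obtain ⟨y, rfl⟩ := hsurj c
    let e : {x : P // f x = f y} ≃
        orbit Q y.1.1 × {ψ' : Q →* ℂˣ // ∀ x ∈ stabilizer Q y.1.1, ψ' x = y.2 x} :=
      { toFun := fun x => (⟨x.1.1.1, ((hfeq _ _).1 x.2).1⟩,
          ⟨x.1.2, fun z hz => (((hfeq _ _).1 x.2.symm).2 z hz).symm⟩)
        invFun := fun z => ⟨(⟨z.1.1, by rw [orbit_eq_iff.2 z.1.2, y.1.2]⟩, z.2.1),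
          ((hfeq _ _).2 ⟨(mem_orbit_symm).1 z.1.2, fun w hw => (z.2.2 w hw).symm⟩).symm⟩
        left_inv := fun _ => rfl
        right_inv := fun _ => rfl }
    rw [Nat.card_congr e, Nat.card_prod, card_eq_on_stabilizer, y.1.2, sq]
  have := Fintype.ofFinite (Quotient (irrSetoid (N ⋊[φ] Q) d))
  have h : Nat.card P = Nat.card (Quotient (irrSetoid (N ⋊[φ] Q) d)) * d ^ 2 := by
    rw [← Nat.card_congr (Equiv.sigmaFiberEquiv f), Nat.card_sigma]
    simp [hfib, Nat.card_eq_fintype_card]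
  rw [← h, Nat.card_prod, CommGroup.card_monoidHom_of_hasEnoughRootsOfUnity]

end GroupRep

/-! ### Representations of a skew left brace as representations of its semidirect product. -/

namespace SkewLeftBrace

variable {A B : Type*} (S : SkewLeftBrace A)

/-- The identity map from the multiplicative to the additive group. -/
def toDot (a : S.Circ) : S.Dot := a

/-- The identity map from the additive to the multiplicative group. -/
def toCirc (a : S.Dot) : S.Circ := a

theorem toDot_toCirc (a : S.Dot) : S.toDot (S.toCirc a) = a := rfl

theorem toCirc_toDot (a : S.Circ) : S.toCirc (S.toDot a) = a := rfl

theorem lambdaOp_def (a : S.Circ) (b : S.Dot) :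
    S.lambdaOp a b = S.toDot (a * S.toCirc b) * (S.toDot a)⁻¹ := rfl

theorem toDot_mul_toCirc_mul (a : S.Circ) (b c : S.Dot) :
    S.toDot (a * S.toCirc (b * c)) =
      S.toDot (a * S.toCirc b) * (S.toDot a)⁻¹ * S.toDot (a * S.toCirc c) :=
  S.compat a b c

theorem toDot_one : S.toDot 1 = 1 := by
  have h := S.toDot_mul_toCirc_mul 1 1 1
  rw [mul_one, mul_assoc, left_eq_mul, inv_mul_eq_one, one_mul, toDot_toCirc] at h
  exact h

theorem lambdaOp_mul (a : S.Circ) (b c : S.Dot) :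
    S.lambdaOp a (b * c) = S.lambdaOp a b * S.lambdaOp a c := by
  simp only [lambdaOp_def, toDot_mul_toCirc_mul, mul_assoc]

theorem lambdaOp_one (b : S.Dot) : S.lambdaOp 1 b = b := by
  rw [lambdaOp_def, one_mul, toDot_one, inv_one, mul_one, toDot_toCirc]

/-- The action of the multiplicative group on the additive group, by endomorphisms. -/
def lambdaEnd : S.Circ →* Monoid.End S.Dot where
  toFun a := MonoidHom.mk' (S.lambdaOp a) (S.lambdaOp_mul a)
  map_one' := MonoidHom.ext S.lambdaOp_one
  map_mul' a b := by
    refine MonoidHom.ext fun c => ?_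
    change S.lambdaOp (a * b) c = MonoidHom.mk' (S.lambdaOp a) (S.lambdaOp_mul a) (S.lambdaOp b c)
    -- Expanding `(b ∘ c) · b⁻¹` under the endomorphism of `a` gives `(a ∘ b ∘ c) · a⁻¹ · ((a ∘ b) ·
    -- a⁻¹)⁻¹`, where the factors `a⁻¹` cancel.
    rw [S.lambdaOp_def b, map_mul, map_inv]
    simp only [MonoidHom.mk'_apply, lambdaOp_def, toCirc_toDot, mul_assoc, mul_inv_rev, inv_inv,
      inv_mul_cancel_left]

/-- The action of the multiplicative group on the additive group, by automorphisms. -/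
def lambdaHom : S.Circ →* MulAut S.Dot where
  toFun a := MonoidHom.toMulEquiv (S.lambdaEnd a) (S.lambdaEnd a⁻¹)
    (by change S.lambdaEnd a⁻¹ * S.lambdaEnd a = 1; rw [← map_mul, inv_mul_cancel, map_one])
    (by change S.lambdaEnd a * S.lambdaEnd a⁻¹ = 1; rw [← map_mul, mul_inv_cancel, map_one])
  map_one' := MulEquiv.ext fun b => S.lambdaOp_one b
  map_mul' a b := MulEquiv.ext fun c => DFunLike.congr_fun (S.lambdaEnd.map_mul a b) c

theorem lambdaHom_apply (a : S.Circ) (b : S.Dot) : S.lambdaHom a b = S.lambdaOp a b := rfl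

/-- The semidirect product of the additive group by the multiplicative group. -/
abbrev SemiProd : Type _ := S.Dot ⋊[S.lambdaHom] S.Circ

section Rep

variable {S} {k V : Type*} [Field k] [AddCommGroup V] [Module k V]

theorem Rep.ext {R R' : S.Rep k V} (h₁ : ∀ a, R.β a = R'.β a) (h₂ : ∀ a, R.ρ a = R'.ρ a) :
    R = R' := by
  obtain ⟨β, ρ, _⟩ := R
  obtain ⟨β', ρ', _⟩ := R'
  obtain rfl : β = β' := MonoidHom.ext h₁
  obtain rfl : ρ = ρ' := MonoidHom.ext h₂
  rfl

variable (S k V) in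
/-- Representations of a skew left brace are the representations of its semidirect product. -/
def repEquiv : S.Rep k V ≃ Representation k S.SemiProd V where
  toFun R :=
    { toFun := fun x => R.β x.left * R.ρ x.right
      map_one' := by simp
      map_mul' := fun x y => by
        simp only [SemidirectProduct.mul_left, SemidirectProduct.mul_right, lambdaHom_apply,
          map_mul, R.compat, mul_assoc]
        rw [← mul_assoc (R.ρ x.right⁻¹), ← map_mul R.ρ, inv_mul_cancel, map_one, one_mul] }
  invFun T :=
    { β := T.comp SemidirectProduct.inl
      ρ := T.comp SemidirectProduct.inr
      compat := fun a b => by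
        simp only [MonoidHom.comp_apply, ← map_mul]
        rw [← SemidirectProduct.inl_aut]
        rfl }
  left_inv R := Rep.ext (fun a => by simp) (fun a => by simp)
  right_inv T := MonoidHom.ext fun x => by
    simp only [MonoidHom.comp_apply, MonoidHom.coe_mk, OneHom.coe_mk]
    rw [← map_mul, SemidirectProduct.inl_left_mul_inr_right]

theorem repEquiv_apply (R : S.Rep k V) (x : S.SemiProd) :
    repEquiv S k V R x = R.β x.left * R.ρ x.right := rfl

end Rep

variable {V W : Type*} [AddCommGroup V] [Module ℂ V] [AddCommGroup W] [Module ℂ W]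
  {S} {Γ : Type*} [Group Γ]

/-- Transport of representations along an isomorphism of the semidirect product with `Γ`. -/
noncomputable def repEquivOfMulEquiv (e : S.SemiProd ≃* Γ) (V : Type*) [AddCommGroup V] [Module ℂ V] :
    S.Rep ℂ V ≃ Representation ℂ Γ V :=
  (repEquiv S ℂ V).trans (e.monoidHomCongrLeftEquiv)

theorem repEquivOfMulEquiv_apply (e : S.SemiProd ≃* Γ) (R : S.Rep ℂ V) (x : S.SemiProd) (v : V) :
    repEquivOfMulEquiv e V R (e x) v = R.β x.left (R.ρ x.right v) := by
  simp [repEquivOfMulEquiv, repEquiv_apply]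

theorem isIrr_repEquivOfMulEquiv (e : S.SemiProd ≃* Γ) (R : S.Rep ℂ V) :
    GroupRep.IsIrr (repEquivOfMulEquiv e V R) ↔ R.IsIrreducible := by
  refine and_congr_right fun _ => forall_congr' fun X => ?_
  have h : (∀ g, ∀ v ∈ X, repEquivOfMulEquiv e V R g v ∈ X) ↔
      (∀ a, ∀ v ∈ X, R.β a v ∈ X) ∧ (∀ a, ∀ v ∈ X, R.ρ a v ∈ X) := by
    rw [e.surjective.forall]
    simp only [repEquivOfMulEquiv_apply]
    refine ⟨fun h => ⟨fun a v hv => ?_, fun a v hv => ?_⟩, fun h x v hv => h.1 _ _ (h.2 _ _ hv)⟩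
    · simpa using h (SemidirectProduct.inl a) v hv
    · simpa using h (SemidirectProduct.inr a) v hv
  rw [h, and_imp]

theorem equivalent_repEquivOfMulEquiv (e : S.SemiProd ≃* Γ) (R : S.Rep ℂ V) (R' : S.Rep ℂ W) :
    GroupRep.Equivalent (repEquivOfMulEquiv e V R) (repEquivOfMulEquiv e W R') ↔
      R.IsEquiv R' := by
  refine exists_congr fun f => ?_
  rw [e.surjective.forall]
  simp only [repEquivOfMulEquiv_apply]
  refine ⟨fun h => ⟨fun a v => ?_, fun a v => ?_⟩, fun h x v => by rw [h.1, h.2]⟩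
  · simpa using h (SemidirectProduct.inl a) v
  · simpa using h (SemidirectProduct.inr a) v

theorem numIrr_eq (e : S.SemiProd ≃* Γ) (d : ℕ) :
    S.numIrr d = ENat.card (Quotient (GroupRep.irrSetoid Γ d)) :=
  ENat.card_congr (Quotient.congr ((repEquivOfMulEquiv e _).subtypeEquiv fun R =>
    (isIrr_repEquivOfMulEquiv e R).symm) fun R R' =>
      (equivalent_repEquivOfMulEquiv e R.1 R'.1).symm)

section SemidirectProduct

open MulAction GroupRep

variable {N Q : Type*} [CommGroup N] [CommGroup Q] [Finite N] [Finite Q] {φ : Q →* MulAut N}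

theorem numIrr_eq_of_card (e : S.SemiProd ≃* N ⋊[φ] Q) {d m : ℕ} (hd : d ≠ 0)
    (h : Nat.card {χ : Chars φ // Nat.card (orbit Q χ) = d} * Nat.card Q = m * d ^ 2) :
    S.numIrr d = (m : ℕ∞) := by
  obtain ⟨hfin, hcard⟩ := card_irr_mul_sq φ d
  rw [numIrr_eq e, ENat.card_eq_coe_natCard, Nat.cast_inj]
  exact Nat.eq_of_mul_eq_mul_right (pow_pos (Nat.pos_of_ne_zero hd) 2) (hcard.trans h)

theorem irrDimsIn_of_orbit {A : Type u} {S : SkewLeftBrace A} (e : S.SemiProd ≃* N ⋊[φ] Q)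
    {D : Set ℕ} (h : ∀ χ : Chars φ, Nat.card (orbit Q χ) ∈ D) : IrrDimsIn.{u, v} S D := by
  intro V _ _ R hR
  obtain ⟨hV, χ, hχ⟩ := finrank_mem_orbit_cards ((isIrr_repEquivOfMulEquiv e R).2 hR)
  exact ⟨hV, hχ ▸ h χ⟩

end SemidirectProduct

/-- Isomorphic skew left braces have isomorphic semidirect products. -/
theorem IsIso.nonempty_semiProd_mulEquiv {A B : Type*} {S : SkewLeftBrace A}
    {T : SkewLeftBrace B} (h : S.IsIso T) : Nonempty (S.SemiProd ≃* T.SemiProd) := by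
  obtain ⟨f, h₁, h₂⟩ := h
  let f₁ : S.Dot ≃* T.Dot := { f with map_mul' := h₁ }
  let f₂ : S.Circ ≃* T.Circ := { f with map_mul' := h₂ }
  refine ⟨SemidirectProduct.congr f₁ f₂ fun a => MulEquiv.ext fun b => ?_⟩
  have h : f₁ (S.lambdaOp a b) = T.lambdaOp (f₂ a) (f₁ b) := by
    rw [lambdaOp_def, lambdaOp_def, map_mul, map_inv]
    have : f₁ (S.toDot (a * S.toCirc b)) = T.toDot (f₂ (a * S.toCirc b)) := rfl
    rw [this, map_mul]
    rfl
  exact h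

/-- A skew left brace with trivial `lambdaHom` and commutative additive group has only
one-dimensional irreducible representations, as many as the square of its order. -/
theorem irr_of_lambdaHom_eq_one {A : Type u} [Finite A] {S : SkewLeftBrace A}
    (hc : ∀ a b : S.Dot, a * b = b * a) (hl : ∀ a b, S.lambdaOp a b = b) :
    S.numIrr 1 = ((Nat.card A ^ 2 : ℕ) : ℕ∞) ∧ IrrDimsIn.{u, v} S {1} := by
  -- A trivial `lambdaOp` means `a ∘ b = b · a`, so `∘` inherits commutativity from `·`.
  have hc' : ∀ a b : S.Circ, a * b = b * a := fun a b => by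
    have key : ∀ a b : S.Circ, S.toDot (a * b) = S.toDot b * S.toDot a := fun a b =>
      mul_inv_eq_iff_eq_mul.1 (hl a (S.toDot b))
    exact (key a b).trans ((hc _ _).trans (key b a).symm)
  let _ : CommGroup S.Dot := { (inferInstance : Group S.Dot) with mul_comm := hc }
  let _ : CommGroup S.Circ := { (inferInstance : Group S.Circ) with mul_comm := hc' }
  have : Finite S.Dot := inferInstanceAs (Finite A)
  have : Finite S.Circ := inferInstanceAs (Finite A)
  have hs : ∀ (a : S.Circ) (χ : GroupRep.Chars S.lambdaHom), a • χ = χ := fun a χ =>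
    DFunLike.ext _ _ fun n => by
      rw [GroupRep.smul_char_apply, lambdaHom_apply, hl]
  have ho : ∀ χ : GroupRep.Chars S.lambdaHom, Nat.card (MulAction.orbit S.Circ χ) = 1 := by
    intro χ
    rw [Nat.card_eq_one_iff_unique]
    refine ⟨⟨?_⟩, ⟨⟨χ, MulAction.mem_orbit_self χ⟩⟩⟩
    rintro ⟨_, a, rfl⟩ ⟨_, b, rfl⟩
    simp [hs]
  let e : S.SemiProd ≃* S.Dot ⋊[S.lambdaHom] S.Circ := MulEquiv.refl _
  refine ⟨numIrr_eq_of_card e one_ne_zero ?_, irrDimsIn_of_orbit e fun χ => ho χ⟩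
  rw [Nat.card_congr (Equiv.subtypeUnivEquiv ho)]
  have h := CommGroup.card_monoidHom_of_hasEnoughRootsOfUnity S.Dot ℂ
  change Nat.card (GroupRep.Chars S.lambdaHom) = Nat.card A at h
  rw [h, show Nat.card S.Circ = Nat.card A from rfl]
  ring

end SkewLeftBrace

/-! ### The case `p ≢ 1 mod q` and the brace `B`: trivial actions. -/

section PrimeMulPrime

variable {p q : ℕ} [Fact p.Prime]

theorem not_dvd_sub_one (h : ¬ p ≡ 1 [MOD q]) : ¬ q ∣ p - 1 := fun h' =>
  h ((Nat.modEq_iff_dvd' (Fact.out : p.Prime).one_lt.le).2 h').symm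

variable [Fact q.Prime]

/-- The order is squarefree, so all Sylow subgroups are cyclic. Sylow's counting makes them normal,
so the group is nilpotent, and a finite nilpotent group with cyclic Sylow subgroups is cyclic. -/
theorem isCyclic_of_card_eq_prime_mul_prime {H : Type*} [Group H] (hpq : q < p)
    (h : ¬ p ≡ 1 [MOD q]) (hH : Nat.card H = p * q) : IsCyclic H := by
  have hp : p.Prime := Fact.out
  have hq : q.Prime := Fact.out
  have hfin : Finite H := Nat.finite_of_card_ne_zero (by rw [hH]; exact (mul_pos hp.pos hq.pos).ne')
  have : IsZGroup H := IsZGroup.of_squarefree (by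
    rw [hH, Nat.squarefree_mul ((Nat.coprime_primes hp hq).2 hpq.ne')]
    exact ⟨hp.squarefree, hq.squarefree⟩)
  have : Group.IsNilpotent H := by
    suffices hN : ∀ (r : ℕ) (_ : Fact r.Prime) (P : Sylow r H), (P : Subgroup H).Normal from
      ((Group.isNilpotent_of_finite_tfae (G := H)).out 0 3).2 hN
    intro r hr P
    have hidx : ∀ s : ℕ, r * s = p * q → Nat.card (Sylow r H) ∣ s := fun s hs => by
      obtain ⟨k, hk⟩ := P.dvd_card_of_dvd_card (by rw [hH, ← hs]; exact dvd_mul_right r s)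
      have h1 := P.card_mul_index
      rw [hk, hH, ← hs, mul_assoc] at h1
      exact P.card_dvd_index.trans ⟨k, by rw [mul_comm]; exact (Nat.eq_of_mul_eq_mul_left
        hr.out.pos h1).symm⟩
    have hmod := card_sylow_modEq_one r H
    have key : Nat.card (Sylow r H) = 1 → (P : Subgroup H).Normal := fun h1 => by
      have : Subsingleton (Sylow r H) := (Nat.card_eq_one_iff_unique.1 h1).1
      exact P.normal_of_subsingleton
    by_cases hrp : r = p
    · subst hrp
      rcases (Nat.dvd_prime hq).1 (hidx q rfl) with h1 | h1
      · exact key h1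
      -- Having `q` Sylow `p`-subgroups would give `q ≡ 1 mod p`, impossible for `1 < q < p`.
      · rw [h1, Nat.ModEq, Nat.mod_eq_of_lt hpq, Nat.mod_eq_of_lt hp.one_lt] at hmod
        exact absurd hmod hq.one_lt.ne'
    by_cases hrq : r = q
    · subst hrq
      rcases (Nat.dvd_prime hp).1 (hidx p (mul_comm _ _)) with h1 | h1
      · exact key h1
      · exact absurd (h1 ▸ hmod) h
    have hbot : (P : Subgroup H) = ⊥ := by
      obtain ⟨n, hn⟩ := P.isPGroup'.exists_card_eq
      rw [← Subgroup.card_eq_one, hn]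
      have hdvd : r ^ n ∣ p * q := hn ▸ hH ▸ Subgroup.card_subgroup_dvd_card _
      rcases n.eq_zero_or_pos with rfl | hn0
      · rfl
      · rcases (Nat.Prime.dvd_mul hr.out).1 ((dvd_pow_self r hn0.ne').trans hdvd) with h1 | h1
        · exact absurd ((Nat.prime_dvd_prime_iff_eq hr.out hp).1 h1) hrp
        · exact absurd ((Nat.prime_dvd_prime_iff_eq hr.out hq).1 h1) hrq
    rw [hbot]
    infer_instance
  infer_instance

/-- The additive group is cyclic, so its automorphism group has order `(p - 1) * (q - 1)`, which is
prime to `p * q`. A homomorphism to it from a group of order `p * q` is trivial. -/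
theorem lambdaOp_eq_of_not_modEq {A : Type*} (hpq : q < p) (h : ¬ p ≡ 1 [MOD q])
    (S : SkewLeftBrace A) (hA : Nat.card A = p * q) (a : S.Circ) (b : S.Dot) :
    S.lambdaOp a b = b := by
  have hp : p.Prime := Fact.out
  have hq : q.Prime := Fact.out
  have hfin : Finite A := Nat.finite_of_card_ne_zero (by rw [hA]; exact (mul_pos hp.pos hq.pos).ne')
  have : Finite S.Dot := inferInstanceAs (Finite A)
  have : IsCyclic S.Dot := isCyclic_of_card_eq_prime_mul_prime hpq h hA
  have h1 : orderOf (S.lambdaHom a) ∣ (p - 1) * (q - 1) := by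
    have h2 := orderOf_dvd_natCard (S.lambdaHom a)
    rwa [IsCyclic.card_mulAut, show Nat.card S.Dot = p * q from hA,
      Nat.totient_mul ((Nat.coprime_primes hp hq).2 hpq.ne'), Nat.totient_prime hp,
      Nat.totient_prime hq] at h2
  have h2 : orderOf (S.lambdaHom a) ∣ p * q :=
    (orderOf_map_dvd _ _).trans (hA ▸ orderOf_dvd_natCard (G := S.Circ) a)
  have hlt : ∀ {r s : ℕ}, s.Prime → s ≤ r → ¬ r ∣ s - 1 := fun hs hr hd => by
    have := Nat.le_of_dvd (Nat.sub_pos_of_lt hs.one_lt) hd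
    have := hs.one_lt
    omega
  have hcop : Nat.Coprime ((p - 1) * (q - 1)) (p * q) := by
    refine Nat.Coprime.mul_right ?_ ?_ <;> rw [Nat.coprime_comm]
    · rw [hp.coprime_iff_not_dvd, hp.dvd_mul, not_or]
      exact ⟨hlt hp le_rfl, hlt hq hpq.le⟩
    · rw [hq.coprime_iff_not_dvd, hq.dvd_mul, not_or]
      exact ⟨not_dvd_sub_one h, hlt hq le_rfl⟩
  have h3 : S.lambdaHom a = 1 := orderOf_eq_one_iff.1 (Nat.eq_one_of_dvd_coprimes hcop h1 h2)
  exact DFunLike.congr_fun h3 b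

theorem irr_of_not_modEq {A : Type u} (hpq : q < p) (h : ¬ p ≡ 1 [MOD q])
    (S : SkewLeftBrace A) (hA : Nat.card A = p * q) :
    S.numIrr 1 = ((p ^ 2 * q ^ 2 : ℕ) : ℕ∞) ∧ SkewLeftBrace.IrrDimsIn.{u, v} S {1} := by
  have hp : p.Prime := Fact.out
  have hq : q.Prime := Fact.out
  have hfin : Finite A := Nat.finite_of_card_ne_zero (by rw [hA]; exact (mul_pos hp.pos hq.pos).ne')
  have : IsCyclic S.Dot := isCyclic_of_card_eq_prime_mul_prime hpq h hA
  rw [← mul_pow, ← hA]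
  exact SkewLeftBrace.irr_of_lambdaHom_eq_one (IsCyclic.commGroup (α := S.Dot)).mul_comm
    (lambdaOp_eq_of_not_modEq hpq h S hA)

theorem irr_of_isIso_B {A : Type u} (S : SkewLeftBrace A) (hA : Nat.card A = p * q)
    (hS : S.IsIso (PQBrace.B p q)) :
    S.numIrr 1 = ((p ^ 2 * q ^ 2 : ℕ) : ℕ∞) ∧ SkewLeftBrace.IrrDimsIn.{u, v} S {1} := by
  have hp : p.Prime := Fact.out
  have hq : q.Prime := Fact.out
  have hfin : Finite A := Nat.finite_of_card_ne_zero (by rw [hA]; exact (mul_pos hp.pos hq.pos).ne')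
  rw [← mul_pow, ← hA]
  obtain ⟨f, h₁, h₂⟩ := hS
  have hB : ∀ x y, (PQBrace.B p q).dot.mul x y = (PQBrace.B p q).dot.mul y x := by
    rintro ⟨n, m⟩ ⟨s, t⟩
    refine Prod.ext ?_ (add_comm m t)
    change PQBrace.zpw 1 t * n + PQBrace.zpw 1 m * s = PQBrace.zpw 1 m * s + PQBrace.zpw 1 t * n
    ring
  have hc : ∀ a b : S.Dot, a * b = b * a := fun a b =>
    f.injective ((h₁ a b).trans ((hB _ _).trans (h₁ b a).symm))
  refine SkewLeftBrace.irr_of_lambdaHom_eq_one hc fun a b => ?_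
  -- The two operations coincide in `B`, hence in `S`.
  have e : S.toDot (a * S.toCirc b) = S.toDot a * b :=
    f.injective ((h₂ a b).trans (h₁ a b).symm)
  rw [SkewLeftBrace.lambdaOp_def, e, hc, inv_mul_cancel_left]

end PrimeMulPrime

/-! ### Orbits of characters of `(ℤ/p)²` under a diagonal action. -/

namespace GroupRep

open MulAction

variable {p : ℕ}

/-- Multiplication by a unit, as an automorphism of the additive group of `ZMod p`. -/
def unitAut (p : ℕ) : (ZMod p)ˣ →* MulAut (Multiplicative (ZMod p)) where
  toFun u :=
    { toFun := fun n => Multiplicative.ofAdd ((u : ZMod p) * n.toAdd)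
      invFun := fun n => Multiplicative.ofAdd (((u⁻¹ : (ZMod p)ˣ) : ZMod p) * n.toAdd)
      left_inv := fun n => by simp
      right_inv := fun n => by simp
      map_mul' := fun n n' => by simp [mul_add] }
  map_one' := MulEquiv.ext fun n => congr_arg Multiplicative.ofAdd (one_mul n.toAdd)
  map_mul' u v := MulEquiv.ext fun n => congr_arg Multiplicative.ofAdd (mul_assoc _ _ n.toAdd)

theorem unitAut_apply (u : (ZMod p)ˣ) (n : Multiplicative (ZMod p)) :
    unitAut p u n = Multiplicative.ofAdd ((u : ZMod p) * n.toAdd) := rfl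

variable {Q : Type*} [CommGroup Q]

/-- The action of `Q` on `(ℤ/p)²` that is diagonal with entries `χ₁` and `χ₂`. -/
def diagAct (χ₁ χ₂ : Q →* (ZMod p)ˣ) :
    Q →* MulAut (Multiplicative (ZMod p) × Multiplicative (ZMod p)) where
  toFun x := MulEquiv.prodCongr (unitAut p (χ₁ x)) (unitAut p (χ₂ x))
  map_one' := by simp; rfl
  map_mul' x y := by simp; rfl

theorem diagAct_apply (χ₁ χ₂ : Q →* (ZMod p)ˣ) (x : Q)
    (n : Multiplicative (ZMod p) × Multiplicative (ZMod p)) :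
    diagAct χ₁ χ₂ x n = (Multiplicative.ofAdd ((χ₁ x : ZMod p) * n.1.toAdd),
      Multiplicative.ofAdd ((χ₂ x : ZMod p) * n.2.toAdd)) := rfl

variable [Fact p.Prime]

/-- Invariance says that `η` kills all multiples of `u - 1`. If `u ≠ 1` this is a unit of the field
`ℤ/p`, so `η` is trivial. -/
theorem char_unitAut_eq_iff (η : Multiplicative (ZMod p) →* ℂˣ) (u : (ZMod p)ˣ) :
    (∀ n, η (unitAut p u n) = η n) ↔ (η ≠ 1 → u = 1) := by
  constructor
  · intro h hη
    by_contra hu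
    refine hη (MonoidHom.ext fun k => ?_)
    have hu' : (u : ZMod p) - 1 ≠ 0 := fun h' => hu (Units.ext (sub_eq_zero.1 h'))
    have h1 := h (Multiplicative.ofAdd (((u : ZMod p) - 1)⁻¹ * k.toAdd))
    rw [unitAut_apply, ← div_eq_one, ← map_div, ← ofAdd_sub, toAdd_ofAdd, ← sub_one_mul,
      mul_inv_cancel_left₀ hu', ofAdd_toAdd] at h1
    exact h1
  · intro h n
    by_cases hη : η = 1
    · simp [hη]
    · rw [h hη, map_one, MulAut.one_apply]

variable (χ₁ χ₂ : Q →* (ZMod p)ˣ)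

/-- The characters of `(ℤ/p)²` as pairs of characters of `ℤ/p`. -/
def charsEquiv : Chars (diagAct χ₁ χ₂) ≃
    (Multiplicative (ZMod p) →* ℂˣ) × (Multiplicative (ZMod p) →* ℂˣ) where
  toFun η := (MonoidHom.comp η (MonoidHom.inl _ _), MonoidHom.comp η (MonoidHom.inr _ _))
  invFun η := MonoidHom.coprod η.1 η.2
  left_inv η := MonoidHom.coprod_unique (f := (η : _ →* ℂˣ))
  right_inv η := by simp

variable {χ₁ χ₂} in
theorem smul_eq_iff (η : Chars (diagAct χ₁ χ₂)) (x : Q) :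
    x • η = η ↔ ((charsEquiv χ₁ χ₂ η).1 ≠ 1 → χ₁ x = 1) ∧
      ((charsEquiv χ₁ χ₂ η).2 ≠ 1 → χ₂ x = 1) := by
  obtain ⟨⟨η₁, η₂⟩, rfl⟩ := (charsEquiv χ₁ χ₂).symm.surjective η
  rw [Equiv.apply_symm_apply, ← char_unitAut_eq_iff, ← char_unitAut_eq_iff]
  have hη : ∀ n, (charsEquiv χ₁ χ₂).symm (η₁, η₂) n = η₁ n.1 * η₂ n.2 := fun _ => rfl
  rw [← eq_inv_smul_iff, eq_comm]
  constructor
  · intro h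
    have h' : ∀ n : Multiplicative (ZMod p) × Multiplicative (ZMod p),
        η₁ (unitAut p (χ₁ x) n.1) * η₂ (unitAut p (χ₂ x) n.2) = η₁ n.1 * η₂ n.2 := fun n => by
      have := DFunLike.congr_fun h n
      rw [smul_char_apply, inv_inv] at this
      exact this
    exact ⟨fun n => by simpa using h' (n, 1), fun n => by simpa using h' (1, n)⟩
  · rintro ⟨h₁, h₂⟩
    refine DFunLike.ext _ _ fun n => ?_
    rw [smul_char_apply, inv_inv, hη, hη]
    exact congr_arg₂ _ (h₁ _) (h₂ _)

variable {χ₁ χ₂} in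
theorem card_orbit_eq_card_range [Finite Q] {H : Type*} [Group H]
    {η : Chars (diagAct χ₁ χ₂)} (f : Q →* H) (h : ∀ x, x • η = η ↔ f x = 1) :
    Nat.card (orbit Q η) = Nat.card f.range := by
  rw [Nat.card_congr (orbitEquivQuotientStabilizer Q η),
    ← Nat.card_congr (QuotientGroup.quotientKerEquivRange f).toEquiv]
  have : stabilizer Q η = f.ker := by
    ext x
    exact h x
  rw [this]

variable {χ₁ χ₂} in
open Classical in
-- Only the acting characters at nontrivial components constrain the stabilizer, which is thus the
-- kernel of their product; the orbit has the size of the image.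
theorem card_orbit_diagAct [Finite Q] (η : Chars (diagAct χ₁ χ₂)) :
    Nat.card (orbit Q η) =
      if (charsEquiv χ₁ χ₂ η).1 = 1 then
        if (charsEquiv χ₁ χ₂ η).2 = 1 then 1 else Nat.card χ₂.range
      else if (charsEquiv χ₁ χ₂ η).2 = 1 then Nat.card χ₁.range
        else Nat.card (χ₁.prod χ₂).range := by
  have h := smul_eq_iff η
  split_ifs with h1 h2 h2 <;> simp only [h1, h2, ne_eq, not_true, not_false_iff, true_imp_iff,
    false_imp_iff, and_true, true_and] at h
  · rw [card_orbit_eq_card_range (1 : Q →* Q) (by simpa using h), Nat.card_eq_one_iff_unique]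
    simp [MonoidHom.range_one]
    infer_instance
  · exact card_orbit_eq_card_range χ₂ h
  · exact card_orbit_eq_card_range χ₁ h
  · refine card_orbit_eq_card_range (χ₁.prod χ₂) fun x => ?_
    rw [h, MonoidHom.prod_apply, Prod.mk_eq_one]

theorem sum_ite_eq_one {H : Type*} [CommGroup H] [Fintype H] [∀ x : H, Decidable (x = 1)]
    {n : ℕ} (hn : Fintype.card H = n) (a b : ℕ) :
    ∑ x : H, (if x = 1 then a else b) = a + (n - 1) * b := by
  classical
  rw [← Finset.add_sum_erase _ _ (Finset.mem_univ (1 : H)), if_pos rfl,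
    Finset.sum_congr rfl fun x hx => if_neg (Finset.ne_of_mem_erase hx), Finset.sum_const,
    Finset.card_erase_of_mem (Finset.mem_univ _), Finset.card_univ, smul_eq_mul, hn]

/-- The number of characters of `(ℤ/p)²` with an orbit of size `d` for a diagonal action. -/
theorem card_chars_diagAct [Finite Q] (d : ℕ) :
    Nat.card {η : Chars (diagAct χ₁ χ₂) // Nat.card (orbit Q η) = d} =
      (if 1 = d then 1 else 0) + (p - 1) * (if Nat.card χ₂.range = d then 1 else 0) +
        (p - 1) * ((if Nat.card χ₁.range = d then 1 else 0) +
          (p - 1) * (if Nat.card (χ₁.prod χ₂).range = d then 1 else 0)) := by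
  classical
  have := Fintype.ofFinite (Multiplicative (ZMod p) →* ℂˣ)
  have hc : Fintype.card (Multiplicative (ZMod p) →* ℂˣ) = p := by
    rw [← Nat.card_eq_fintype_card, CommGroup.card_monoidHom_of_hasEnoughRootsOfUnity]
    simp
  rw [Nat.card_congr ((charsEquiv χ₁ χ₂).subtypeEquiv
    (q := fun η => (if η.1 = 1 then if η.2 = 1 then 1 else Nat.card χ₂.range
      else if η.2 = 1 then Nat.card χ₁.range else Nat.card (χ₁.prod χ₂).range) = d)
    fun η => by rw [card_orbit_diagAct]), Nat.card_eq_fintype_card, Fintype.card_subtype,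
    Finset.card_filter, Fintype.sum_prod_type]
  have e : ∀ x : Multiplicative (ZMod p) →* ℂˣ, (∑ y : Multiplicative (ZMod p) →* ℂˣ,
      if (if x = 1 then if y = 1 then 1 else Nat.card χ₂.range
        else if y = 1 then Nat.card χ₁.range else Nat.card (χ₁.prod χ₂).range) = d
      then 1 else 0) = if x = 1 then
        (if 1 = d then 1 else 0) + (p - 1) * (if Nat.card χ₂.range = d then 1 else 0)
      else (if Nat.card χ₁.range = d then 1 else 0) +
        (p - 1) * (if Nat.card (χ₁.prod χ₂).range = d then 1 else 0) := fun x => by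
    by_cases hx : x = 1 <;> simp only [hx, if_true, if_false] <;> rw [← sum_ite_eq_one hc] <;>
      exact Finset.sum_congr rfl fun y _ => by by_cases hy : y = 1 <;> simp only [hy, if_true, if_false]
  simp only [e]
  exact sum_ite_eq_one hc _ _

end GroupRep

/-! ### The semidirect product of `mk` and its two characters. -/

namespace PQBrace

open GroupRep

variable {p q : ℕ} [Fact p.Prime] [Fact q.Prime]

/-- The character `m ↦ u ^ m` of `ℤ/q` with values in the units of `ℤ/p`. -/
def unitHom (u : (ZMod p)ˣ) (hu : u ^ q = 1) : Multiplicative (ZMod q) →* (ZMod p)ˣ where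
  toFun m := u ^ m.toAdd.val
  map_one' := by simp
  map_mul' m t := Units.ext (zpw_add hu m.toAdd t.toAdd)

theorem coe_unitHom (u : (ZMod p)ˣ) (hu : u ^ q = 1) (m : Multiplicative (ZMod q)) :
    (unitHom u hu m : ZMod p) = zpw u m.toAdd := rfl

theorem eq_one_of_unitHom_eq_one {u : (ZMod p)ˣ} (hu : u ^ q = 1) (h1 : u ≠ 1)
    {m : Multiplicative (ZMod q)} (hm : unitHom u hu m = 1) : m = 1 := by
  have h := orderOf_dvd_of_pow_eq_one (show u ^ m.toAdd.val = 1 from hm)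
  rw [orderOf_eq_prime hu h1] at h
  have h0 := Nat.eq_zero_of_dvd_of_lt h (ZMod.val_lt m.toAdd)
  exact (ZMod.val_eq_zero _).1 h0

/-- The complement `(ℤ/q)²` in the semidirect product of one of the skew left braces `mk`. -/
abbrev Compl (q : ℕ) : Type := Multiplicative (ZMod q) × Multiplicative (ZMod q)

section

variable (c a b : (ZMod p)ˣ) (hc : c ^ q = 1) (ha : a ^ q = 1) (hb : b ^ q = 1)

/-- The character `(t, m) ↦ c ^ t * b ^ m`. -/
def fstChar : Compl q →* (ZMod p)ˣ := (unitHom c hc).coprod (unitHom b hb)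

/-- The character `(t, m) ↦ (b / a) ^ m`. -/
def sndChar : Compl q →* (ZMod p)ˣ := (unitHom b hb / unitHom a ha).comp (MonoidHom.snd _ _)

theorem sndChar_eq (x : Compl q) :
    sndChar a b ha hb x = unitHom (b / a) (by rw [div_pow, ha, hb, div_one]) x.2 :=
  (div_pow b a _).symm

theorem coe_fstChar (x : Compl q) :
    (fstChar c b hc hb x : ZMod p) = zpw c x.1.toAdd * zpw b x.2.toAdd := rfl

theorem coe_sndChar (x : Compl q) :
    (sndChar a b ha hb x : ZMod p) = zpw a (-x.2.toAdd) * zpw b x.2.toAdd := by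
  have h1 : (sndChar a b ha hb x : ZMod p) * zpw a x.2.toAdd = zpw b x.2.toAdd := by
    rw [← coe_unitHom a ha, ← coe_unitHom b hb, ← Units.val_mul]
    exact congr_arg _ (div_mul_cancel _ _)
  linear_combination (zpw a (-x.2.toAdd)) * h1 -
    (sndChar a b ha hb x : ZMod p) * zpw_mul_neg ha x.2.toAdd

variable (hac : a = 1 ∨ a = c)

theorem mk_lambdaOp (x : (mk c a b hc ha hb hac).Circ) (y : (mk c a b hc ha hb hac).Dot) :
    (mk c a b hc ha hb hac).lambdaOp x y =
      (zpw b x.2 * y.1 + (zpw a y.2 - zpw c y.2) * x.1, y.2) := by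
  have h1 : ∀ m : ZMod q, zpw (1 : (ZMod p)ˣ) m = 1 := fun m => by simp [zpw]
  refine Prod.ext ?_ ?_
  · change zpw 1 (-x.2) * (zpw a y.2 * x.1 + zpw b x.2 * y.1) +
      zpw c (x.2 + y.2) * (-(zpw 1 (-x.2) * zpw c (-x.2) * x.1)) = _
    simp only [h1, zpw_add hc]
    linear_combination (-(zpw c y.2 * x.1)) * zpw_mul_neg hc x.2
  · change x.2 + y.2 + -x.2 = y.2
    abel

theorem semiProd_mk_mul (x y : (mk c a b hc ha hb hac).SemiProd) :
    (x * y).left.1 = x.left.1 + zpw c x.left.2 *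
        (zpw b x.right.2 * y.left.1 + (zpw a y.left.2 - zpw c y.left.2) * x.right.1) ∧
      (x * y).left.2 = x.left.2 + y.left.2 ∧
      (x * y).right.1 = zpw a y.right.2 * x.right.1 + zpw b x.right.2 * y.right.1 ∧
      (x * y).right.2 = x.right.2 + y.right.2 := by
  have h := mk_lambdaOp c a b hc ha hb hac x.right y.left
  have h1 : ∀ m : ZMod q, zpw (1 : (ZMod p)ˣ) m = 1 := fun m => by simp [zpw]
  refine ⟨?_, ?_, rfl, rfl⟩
  · change zpw 1 ((mk c a b hc ha hb hac).lambdaOp x.right y.left).2 * x.left.1 +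
      zpw c x.left.2 * ((mk c a b hc ha hb hac).lambdaOp x.right y.left).1 = _
    rw [h, h1, one_mul]
  · change x.left.2 + ((mk c a b hc ha hb hac).lambdaOp x.right y.left).2 = _
    rw [h]

/-- If `a = 1`, replacing the first `ℤ/p`-coordinate by that of the product `x.left · x.right` in
the additive group removes the term with `1 - c ^ t`; this generalizes `G ⋊ G ≅ G × G` for
conjugation. If `a = c` that term is already zero, and rescaling by `a ^ (-m)` makes the circle
group an ordinary semidirect product with action `(b / a) ^ m`. -/
theorem nonempty_semiProd_mk_mulEquiv :
    Nonempty ((mk c a b hc ha hb hac).SemiProd ≃*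
      (Multiplicative (ZMod p) × Multiplicative (ZMod p))
        ⋊[diagAct (fstChar c b hc hb) (sndChar a b ha hb)] Compl q) := by
  have hmul := semiProd_mk_mul c a b hc ha hb hac
  have h1 : ∀ m : ZMod q, zpw (1 : (ZMod p)ˣ) m = 1 := fun m => by simp [zpw]
  rcases hac with rfl | rfl
  · refine ⟨
      { toFun := fun x => ⟨(.ofAdd (x.left.1 + zpw c x.left.2 * x.right.1), .ofAdd x.right.1),
          (.ofAdd x.left.2, .ofAdd x.right.2)⟩
        invFun := fun y => ⟨(y.left.1.toAdd - zpw c y.right.1.toAdd * y.left.2.toAdd,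
          y.right.1.toAdd), (y.left.2.toAdd, y.right.2.toAdd)⟩
        left_inv := fun x => SemidirectProduct.ext (Prod.ext (add_sub_cancel_right _ _) rfl) rfl
        right_inv := fun y => SemidirectProduct.ext (Prod.ext (sub_add_cancel (G := ZMod p) _ _) rfl) rfl
        map_mul' := fun x y => ?_ }⟩
    obtain ⟨e1, e2, e3, e4⟩ := hmul x y
    rw [e1, e2, e3, e4]
    refine SemidirectProduct.ext (Prod.ext ?_ ?_) rfl
    · rw [SemidirectProduct.mul_left, diagAct_apply, coe_fstChar]
      refine congr_arg Multiplicative.ofAdd ?_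
      change _ = x.left.1 + zpw c x.left.2 * x.right.1 + zpw c x.left.2 * zpw b x.right.2 *
        (y.left.1 + zpw c y.left.2 * y.right.1)
      rw [h1, h1, zpw_add hc]
      ring
    · rw [SemidirectProduct.mul_left, diagAct_apply, coe_sndChar]
      refine congr_arg Multiplicative.ofAdd ?_
      change _ = x.right.1 + zpw 1 (-x.right.2) * zpw b x.right.2 * y.right.1
      rw [h1, h1]
      ring
  · refine ⟨
      { toFun := fun x => ⟨(.ofAdd x.left.1, .ofAdd (zpw a (-x.right.2) * x.right.1)),
          (.ofAdd x.left.2, .ofAdd x.right.2)⟩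
        invFun := fun y => ⟨(y.left.1.toAdd, y.right.1.toAdd),
          (zpw a y.right.2.toAdd * y.left.2.toAdd, y.right.2.toAdd)⟩
        left_inv := fun x => SemidirectProduct.ext rfl (Prod.ext ?_ rfl)
        right_inv := fun y => SemidirectProduct.ext (Prod.ext rfl ?_) rfl
        map_mul' := fun x y => ?_ }⟩
    · change zpw a x.right.2 * (zpw a (-x.right.2) * x.right.1) = x.right.1
      rw [← mul_assoc, zpw_mul_neg ha, one_mul]
    · refine congr_arg Multiplicative.ofAdd (?_ : zpw a (-y.right.2.toAdd) *
        (zpw a y.right.2.toAdd * y.left.2.toAdd) = y.left.2.toAdd)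
      rw [← mul_assoc, mul_comm (zpw a _), zpw_mul_neg ha, one_mul]
    · obtain ⟨e1, e2, e3, e4⟩ := hmul x y
      rw [e1, e2, e3, e4]
      refine SemidirectProduct.ext (Prod.ext ?_ ?_) rfl
      · rw [SemidirectProduct.mul_left, diagAct_apply, coe_fstChar]
        refine congr_arg Multiplicative.ofAdd ?_
        change _ = x.left.1 + zpw a x.left.2 * zpw b x.right.2 * y.left.1
        ring
      · rw [SemidirectProduct.mul_left, diagAct_apply, coe_sndChar]
        refine congr_arg Multiplicative.ofAdd ?_
        change _ = zpw a (-x.right.2) * x.right.1 +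
          zpw a (-x.right.2) * zpw b x.right.2 * (zpw a (-y.right.2) * y.right.1)
        rw [neg_add, zpw_add ha]
        linear_combination (zpw a (-x.right.2) * x.right.1) * zpw_mul_neg ha y.right.2

end

theorem card_compl : Nat.card (Compl q) = q ^ 2 := by
  simp [sq]

/-- A nontrivial character of `(ℤ/q)²` with values in the units of `ℤ/p` has an image of
order `q`. -/
theorem card_range_eq {χ : Compl q →* (ZMod p)ˣ} (hχ : χ ≠ 1) : Nat.card χ.range = q := by
  -- A finite subgroup of the units of a field is cyclic; its generator is killed by `q` and is not
  -- `1`.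
  obtain ⟨⟨_, x, rfl⟩, hr⟩ := IsCyclic.exists_generator (α := χ.range)
  have hpow : (⟨χ x, x, rfl⟩ : χ.range) ^ q = 1 := Subtype.ext (by
    have hx : x ^ q = 1 := Prod.ext
      (by simpa using pow_card_eq_one' (G := Multiplicative (ZMod q)) (x := x.1))
      (by simpa using pow_card_eq_one' (G := Multiplicative (ZMod q)) (x := x.2))
    change χ x ^ q = 1
    rw [← map_pow, hx, map_one])
  rw [← orderOf_eq_card_of_forall_mem_zpowers hr]
  refine orderOf_eq_prime hpow fun h1 => hχ (MonoidHom.ext fun y => ?_)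
  have hy := hr ⟨χ y, y, rfl⟩
  rw [h1, Subgroup.zpowers_one_eq_bot, Subgroup.mem_bot] at hy
  exact congr_arg Subtype.val hy

theorem ofAdd_one_ne_one : Multiplicative.ofAdd (1 : ZMod q) ≠ 1 := one_ne_zero (α := ZMod q)

theorem fstChar_ne_one_of_left {c b : (ZMod p)ˣ} (hc : c ^ q = 1) (hb : b ^ q = 1) (h : c ≠ 1) :
    fstChar c b hc hb ≠ 1 := fun h' =>
  ofAdd_one_ne_one (eq_one_of_unitHom_eq_one hc h (by
    simpa [fstChar] using DFunLike.congr_fun h' (Multiplicative.ofAdd 1, 1)))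

theorem fstChar_ne_one_of_right {c b : (ZMod p)ˣ} (hc : c ^ q = 1) (hb : b ^ q = 1)
    (h : b ≠ 1) : fstChar c b hc hb ≠ 1 := fun h' =>
  ofAdd_one_ne_one (eq_one_of_unitHom_eq_one hb h (by
    simpa [fstChar] using DFunLike.congr_fun h' (1, Multiplicative.ofAdd 1)))

theorem eq_one_of_sndChar_eq_one {a b : (ZMod p)ˣ} (ha : a ^ q = 1) (hb : b ^ q = 1) (h : b ≠ a)
    {x : Compl q} (hx : sndChar a b ha hb x = 1) : x.2 = 1 :=
  eq_one_of_unitHom_eq_one _ (mt div_eq_one.1 h) ((sndChar_eq a b ha hb x).symm.trans hx)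

theorem sndChar_ne_one {a b : (ZMod p)ˣ} (ha : a ^ q = 1) (hb : b ^ q = 1) (h : b ≠ a) :
    sndChar a b ha hb ≠ 1 := fun h' =>
  ofAdd_one_ne_one (eq_one_of_sndChar_eq_one ha hb h
    (DFunLike.congr_fun h' (1, Multiplicative.ofAdd 1)))

theorem card_range_prod_of_eq {χ χ' : Compl q →* (ZMod p)ˣ} (hχ : χ ≠ 1)
    (h : ∀ x, χ x = 1 → χ' x = 1) : Nat.card (χ.prod χ').range = q := by
  refine Eq.trans ?_ (card_range_eq hχ)
  rw [← Nat.card_congr (QuotientGroup.quotientKerEquivRange χ).toEquiv,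
    ← Nat.card_congr (QuotientGroup.quotientKerEquivRange (χ.prod χ')).toEquiv]
  have : (χ.prod χ').ker = χ.ker := by
    ext x
    simp only [MonoidHom.mem_ker, MonoidHom.prod_apply, Prod.mk_eq_one]
    exact ⟨And.left, fun hx => ⟨hx, h x hx⟩⟩
  rw [this]

/-- The second character depends on `m` alone and forces `m = 1`; the first is then injective in
`t`. So the pair embeds `(ℤ/q)²`. -/
theorem card_range_prod_of_ne {c a b : (ZMod p)ˣ} (hc : c ^ q = 1) (ha : a ^ q = 1)
    (hb : b ^ q = 1) (h1 : c ≠ 1) (h2 : b ≠ a) :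
    Nat.card ((fstChar c b hc hb).prod (sndChar a b ha hb)).range = q ^ 2 := by
  rw [← card_compl, ← Nat.card_congr (MonoidHom.ofInjective (f := (fstChar c b hc hb).prod
    (sndChar a b ha hb)) ?_).toEquiv]
  rw [injective_iff_map_eq_one]
  rintro ⟨t, m⟩ h
  rw [MonoidHom.prod_apply, Prod.mk_eq_one] at h
  obtain ⟨h3, h4⟩ := h
  obtain rfl : m = 1 := eq_one_of_sndChar_eq_one ha hb h2 h4
  rw [eq_one_of_unitHom_eq_one hc h1 (m := t) (by simpa [fstChar] using h3)]
  rfl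

/-! ### Counting irreducible representations in the three types of `mk`. -/

variable {A : Type u} {S : SkewLeftBrace A} {c a b : (ZMod p)ˣ} {hc : c ^ q = 1} {ha : a ^ q = 1}
  {hb : b ^ q = 1} {hac : a = 1 ∨ a = c}

/-- The irreducible representations of a brace isomorphic to `mk`, in terms of the sizes of the
images of the two characters. -/
theorem irr_of_isIso_mk (h : S.IsIso (mk c a b hc ha hb hac)) {d₁ d₂ d₃ : ℕ}
    (h₁ : Nat.card (fstChar c b hc hb).range = d₁) (h₂ : Nat.card (sndChar a b ha hb).range = d₂)
    (h₃ : Nat.card ((fstChar c b hc hb).prod (sndChar a b ha hb)).range = d₃) :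
    (∀ d m : ℕ, d ≠ 0 → ((if 1 = d then 1 else 0) + (p - 1) * (if d₂ = d then 1 else 0) +
        (p - 1) * ((if d₁ = d then 1 else 0) + (p - 1) * (if d₃ = d then 1 else 0))) * q ^ 2 =
          m * d ^ 2 → S.numIrr d = (m : ℕ∞)) ∧
      SkewLeftBrace.IrrDimsIn.{u, v} S {1, d₁, d₂, d₃} := by
  obtain ⟨e₁⟩ := h.nonempty_semiProd_mulEquiv
  obtain ⟨e₂⟩ := nonempty_semiProd_mk_mulEquiv c a b hc ha hb hac
  refine ⟨fun d m hd hm => SkewLeftBrace.numIrr_eq_of_card (e₁.trans e₂) hd ?_,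
    SkewLeftBrace.irrDimsIn_of_orbit (e₁.trans e₂) fun η => ?_⟩
  · rw [card_chars_diagAct, h₁, h₂, h₃, card_compl, hm]
  · rw [card_orbit_diagAct, h₁, h₂, h₃]
    split_ifs <;> simp

/-- This is the type of `C`. Both acting characters equal `(t, m) ↦ b ^ m`, so all `p ^ 2 - 1`
nontrivial characters have orbits of size `q`. -/
theorem irr_of_isIso_mk_one_one (h : S.IsIso (mk 1 1 b (one_pow q) (one_pow q) hb (Or.inl rfl)))
    (h1 : b ≠ 1) :
    S.numIrr 1 = ((q ^ 2 : ℕ) : ℕ∞) ∧ S.numIrr q = ((p ^ 2 - 1 : ℕ) : ℕ∞) ∧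
      SkewLeftBrace.IrrDimsIn.{u, v} S {1, q} := by
  have hq : q.Prime := Fact.out
  have hp : p.Prime := Fact.out
  have hf := fstChar_ne_one_of_right (one_pow q) hb h1
  have he : ∀ x, fstChar 1 b (one_pow q) hb x = 1 → sndChar 1 b (one_pow q) hb x = 1 := by
    intro x hx
    rw [← Units.val_eq_one] at hx ⊢
    rw [coe_fstChar] at hx
    rw [coe_sndChar]
    simpa [zpw] using hx
  obtain ⟨hn, hd⟩ := irr_of_isIso_mk.{u, v} h (card_range_eq hf)
    (card_range_eq (sndChar_ne_one (one_pow q) hb h1)) (card_range_prod_of_eq hf he)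
  refine ⟨hn 1 _ one_ne_zero (by simp [hq.ne_one]), hn q _ hq.ne_zero ?_, by simpa using hd⟩
  -- Writing `p = 1 + r + 1` removes the truncated subtraction.
  obtain ⟨r, rfl⟩ := Nat.exists_eq_add_of_lt hp.one_lt
  rw [if_neg hq.one_lt.ne, if_pos rfl]
  congr 1
  refine Nat.eq_sub_of_add_eq ?_
  rw [add_assoc 1, add_tsub_cancel_left]
  ring

/-- The acting characters are independent: `2 * (p - 1)` characters have orbits of size `q`, and the
`(p - 1) ^ 2` with both components nontrivial have orbits of size `q ^ 2`. -/
theorem irr_of_isIso_mk_of_ne (h : S.IsIso (mk c a b hc ha hb hac)) (h1 : c ≠ 1) (h2 : b ≠ a) :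
    S.numIrr 1 = ((q ^ 2 : ℕ) : ℕ∞) ∧ S.numIrr q = ((2 * (p - 1) : ℕ) : ℕ∞) ∧
      S.numIrr (q ^ 2) = (((p - 1) ^ 2 / q ^ 2 : ℕ) : ℕ∞) ∧
      SkewLeftBrace.IrrDimsIn.{u, v} S {1, q, q ^ 2} := by
  have hq : q.Prime := Fact.out
  obtain ⟨hn, hd⟩ := irr_of_isIso_mk.{u, v} h
    (card_range_eq (fstChar_ne_one_of_left hc hb h1)) (card_range_eq (sndChar_ne_one ha hb h2))
    (card_range_prod_of_ne hc ha hb h1 h2)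
  have hq1 : 1 < q ^ 2 := Nat.one_lt_pow two_ne_zero hq.one_lt
  have hq2 : q < q ^ 2 := by nlinarith [hq.one_lt]
  refine ⟨hn 1 _ one_ne_zero (by simp [hq.ne_one]), hn q _ hq.ne_zero ?_,
    hn _ _ (pow_ne_zero 2 hq.ne_zero) ?_, by simpa using hd⟩
  · rw [if_neg hq.one_lt.ne, if_pos rfl, if_neg hq2.ne']
    ring
  · rw [if_neg hq1.ne, if_neg hq2.ne, if_pos rfl]
    -- The division is exact, since `c` has order `q` in a group of order `p - 1`.
    have hdvd : q ^ 2 ∣ (p - 1) ^ 2 := pow_dvd_pow_of_dvd (by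
      rw [← ZMod.card_units p, ← orderOf_eq_prime hc h1]
      exact orderOf_dvd_card) 2
    rw [sq (q ^ 2), ← mul_assoc, Nat.div_mul_cancel hdvd]
    ring

/-- Here `sndChar` is trivial: the `p` characters with trivial first component are fixed, and the
other `p * (p - 1)` have orbits of size `q`. -/
theorem irr_of_isIso_mk_of_eq (h : S.IsIso (mk c a b hc ha hb hac)) (h1 : c ≠ 1) (h2 : b = a) :
    S.numIrr 1 = ((p * q ^ 2 : ℕ) : ℕ∞) ∧ S.numIrr q = ((p ^ 2 - p : ℕ) : ℕ∞) ∧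
      SkewLeftBrace.IrrDimsIn.{u, v} S {1, q} := by
  have hq : q.Prime := Fact.out
  have hp : p.Prime := Fact.out
  subst h2
  have hs : sndChar b b ha hb = 1 := MonoidHom.ext fun x => div_self' (b ^ x.2.toAdd.val)
  have hf := fstChar_ne_one_of_left hc hb h1
  obtain ⟨hn, hd⟩ := irr_of_isIso_mk.{u, v} h (card_range_eq hf)
    (show Nat.card (sndChar b b ha hb).range = 1 by rw [hs, MonoidHom.range_one]; simp)
    (card_range_prod_of_eq hf fun x _ => by rw [hs]; rfl)
  refine ⟨hn 1 _ one_ne_zero ?_, hn q _ hq.ne_zero ?_, by simpa using hd⟩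
  · rw [if_pos rfl, if_neg hq.ne_one]
    simp [Nat.add_sub_cancel' hp.one_lt.le]
  · rw [if_neg hq.one_lt.ne, if_pos rfl, sq p, ← Nat.mul_sub_one]
    obtain ⟨r, rfl⟩ := Nat.exists_eq_add_of_lt hp.one_lt
    rw [add_assoc 1, add_tsub_cancel_left]
    ring

end PQBrace

/-! ### The classification, family by family. -/

theorem theorem1p1 (p q : ℕ) [Fact p.Prime] [Fact q.Prime] (hpq : q < p)
    {A : Type u} (S : SkewLeftBrace A) (hA : Nat.card A = p * q) :
    (¬ p ≡ 1 [MOD q] →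
      S.numIrr 1 = ((p ^ 2 * q ^ 2 : ℕ) : ℕ∞) ∧ SkewLeftBrace.IrrDimsIn.{u, v} S {1}) ∧
    (p ≡ 1 [MOD q] → S.IsIso (PQBrace.B p q) →
      S.numIrr 1 = ((p ^ 2 * q ^ 2 : ℕ) : ℕ∞) ∧ SkewLeftBrace.IrrDimsIn.{u, v} S {1}) ∧
    (p ≡ 1 [MOD q] → ∀ (g : (ZMod p)ˣ) (hg : orderOf g = q),
      (S.IsIso (PQBrace.C g hg) →
        S.numIrr 1 = ((q ^ 2 : ℕ) : ℕ∞) ∧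
        S.numIrr q = ((p ^ 2 - 1 : ℕ) : ℕ∞) ∧
        SkewLeftBrace.IrrDimsIn.{u, v} S {1, q}) ∧
      ((S.IsIso (PQBrace.D g hg) ∨
          (∃ γ : ℕ, 1 < γ ∧ γ < q ∧ S.IsIso (PQBrace.F g hg γ)) ∨
          (∃ μ : ℕ, 1 < μ ∧ μ ≤ q ∧ S.IsIso (PQBrace.G g hg μ))) →
        S.numIrr 1 = ((q ^ 2 : ℕ) : ℕ∞) ∧
        S.numIrr q = ((2 * (p - 1) : ℕ) : ℕ∞) ∧
        S.numIrr (q ^ 2) = (((p - 1) ^ 2 / q ^ 2 : ℕ) : ℕ∞) ∧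
        SkewLeftBrace.IrrDimsIn.{u, v} S {1, q, q ^ 2}) ∧
      ((S.IsIso (PQBrace.E g hg) ∨ S.IsIso (PQBrace.F g hg q)) →
        S.numIrr 1 = ((p * q ^ 2 : ℕ) : ℕ∞) ∧
        S.numIrr q = ((p ^ 2 - p : ℕ) : ℕ∞) ∧
        SkewLeftBrace.IrrDimsIn.{u, v} S {1, q})) := by
  refine ⟨fun h => irr_of_not_modEq hpq h S hA, fun _ h => irr_of_isIso_B S hA h,
    fun _ g hg => ?_⟩
  have hq : q.Prime := Fact.out
  have hg1 : g ≠ 1 := fun h => hq.ne_one (by rw [← hg, h, orderOf_one])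
  refine ⟨fun h => PQBrace.irr_of_isIso_mk_one_one h hg1, ?_, ?_⟩
  · rintro (h | ⟨γ, h1, h2, h⟩ | ⟨μ, h1, h2, h⟩)
    · exact PQBrace.irr_of_isIso_mk_of_ne h hg1 hg1
    · exact PQBrace.irr_of_isIso_mk_of_ne h hg1
        (pow_ne_one_of_lt_orderOf (by omega) (by omega))
    · refine PQBrace.irr_of_isIso_mk_of_ne h hg1 fun h3 => ?_
      -- For `G_μ`, `b = a` would mean `g ^ μ = g`; but `0 < μ - 1 < q`, also when `μ = q`.
      have h4 : g ^ (μ - 1) = 1 := mul_right_cancel (b := g) (by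
        rw [← pow_succ, Nat.sub_add_cancel h1.le, h3, one_mul])
      exact pow_ne_one_of_lt_orderOf (by omega) (by omega) h4
  · rintro (h | h)
    · exact PQBrace.irr_of_isIso_mk_of_eq h hg1 rfl
    -- For `F_q`, `b = g ^ q = 1 = a`.
    · exact PQBrace.irr_of_isIso_mk_of_eq h hg1 (PQBrace.pow_one hg)
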